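/- Let $\mathfrak g$ be a finite-dimensional simple Lie algebra over $\mathbb C$ with Cartan subalgebra $\mathfrak h$, simple roots $\alpha_i$ ($i\in I$), positive roots $R^+$ and simple coroots $h_i$, where $I$ is identified with the set of nodes of the Dynkin diagram. For $J\subseteq I$ put $\vartheta_J=\sum_{j\in J}\alpha_j$, and let $\partial J$ be the set of nodes of $J$ that are joined to at most one other node of $J$. For a weight $\lambda$ put $\mathrm{supp}(\lambda)=\{i\in I:\lambda(h_i)\neq 0\}$, and for $\alpha=\sum_i s_i\alpha_i\in R^+$ put $\mathrm{rsupp}(\alpha)=\{i\in I: s_i\ne 0\}$. Let $$\mathcal P^\lambda_{\vartheta_J}=\Big\{\xi:R^+\to\mathbb Z_{\ge 0}\ :\ \vartheta_J=\sum_{\alpha\in R^+}\xi(\alpha)\,\alpha,\ \text{ and } \mathrm{rsupp}(\alpha)\cap\mathrm{supp}(\lambda)\neq\emptyset\text{ whenever }\xi(\alpha)\neq 0\Big\}.$$ **Proposition.** Let $J\subseteq I$ be a connected subdiagram, let $\lambda$ be a dominant integral weight with $\mathrm{supp}(\lambda)\cap J\subseteq\partial J$, and let $V(\lambda)$ be an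 irreducible $\mathfrak g$-module of highest weight $\lambda$. Then the set $\mathcal P^\lambda_{\vartheta_J}$ is finite, the weight space $V(\lambda)_{\lambda-\vartheta_J}$ is finite-dimensional, and $$\dim V(\lambda)_{\lambda-\vartheta_J}=\#\mathcal P^\lambda_{\vartheta_J}.$$ Moreover, with $S=\mathrm{supp}(\lambda)\cap J$ and $\overline S$ the minimal connected subdiagram of $I$ containing $S$, $$\#\mathcal P^\lambda_{\vartheta_J}=\begin{cases}1,&\text{if }\#S=1,\\ \#\overline{S},&\text{if }\#S=2,\\ 3(n-2)+1,&\text{if }\#S=3\text{ and }J\text{ is of type }D_n\ (n\ge 4),\\ 4(n-2)-2,&\text{if }\#S=3\text{ and }J\text{ is of type }E_n\ (n=6,7,8).\end{cases}$$ -/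

import Mathlib

open Module

noncomputable section

namespace RootPairing.Base

variable {ι R M N : Type*} [Field R] [CharZero R] [AddCommGroup M] [Module R M]
  [AddCommGroup N] [Module R N] {P : RootPairing ι R M N}

/-- The (simple graph underlying the) Dynkin diagram: its nodes are the simple roots, and two
distinct nodes are joined when the corresponding entry of the Cartan matrix is nonzero. -/
def dynkinGraph [Finite ι] (b : P.Base) : SimpleGraph b.support where
  Adj i j := i ≠ j ∧ P.pairing i j ≠ 0
  symm.symm := fun _ _ h ↦ ⟨h.1.symm, fun h0 ↦ h.2 (P.pairing_eq_zero_iff.mp h0)⟩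
  loopless.irrefl := fun _ h ↦ h.1 rfl

/-- A set of nodes of the Dynkin diagram is connected when the full subdiagram on it is.
The empty subdiagram is allowed. -/
def IsConnectedSub [Finite ι] (b : P.Base) (J : Set b.support) : Prop :=
  (b.dynkinGraph.induce J).Preconnected

/-- The boundary `∂J`: the nodes of `J` joined to at most one other node of `J`. -/
def boundary [Finite ι] (b : P.Base) (J : Set b.support) : Set b.support :=
  {j | j ∈ J ∧ {k | k ∈ J ∧ b.dynkinGraph.Adj j k}.ncard ≤ 1}

/-- The minimal connected subdiagram containing `J`. The Dynkin diagram of an irreducible root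
system is a tree, so this is the intersection of all connected subdiagrams containing `J`. -/
def connectedHull [Finite ι] (b : P.Base) (J : Set b.support) : Set b.support :=
  ⋂₀ {K | J ⊆ K ∧ b.IsConnectedSub K}

/-- The subdiagram `J` has Cartan matrix `A`, up to a relabelling of its nodes. -/
def HasCartanType [Finite ι] [P.IsCrystallographic] (b : P.Base) (J : Finset b.support) {n : ℕ}
    (A : Matrix (Fin n) (Fin n) ℤ) : Prop :=
  ∃ e : J ≃ Fin n, ∀ i j : J, b.cartanMatrix i j = A (e i) (e j)

/-- The subdiagram `J` is of type `D n`, where `n ≥ 4`. -/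
def HasTypeD [Finite ι] [P.IsCrystallographic] (b : P.Base) (J : Finset b.support) (n : ℕ) :
    Prop :=
  4 ≤ n ∧ b.HasCartanType J (CartanMatrix.D n)

/-- The subdiagram `J` is of type `E n`, where `n` is `6`, `7` or `8`. -/
def HasTypeE [Finite ι] [P.IsCrystallographic] (b : P.Base) (J : Finset b.support) (n : ℕ) :
    Prop :=
  (n = 6 ∧ b.HasCartanType J CartanMatrix.E₆) ∨
  (n = 7 ∧ b.HasCartanType J CartanMatrix.E₇) ∨
  (n = 8 ∧ b.HasCartanType J CartanMatrix.E₈)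

/-- `ϑ_J`, the sum of the simple roots in `J`. -/
def theta (b : P.Base) (J : Finset b.support) : M := ∑ j ∈ J, P.root j

/-- The support of a weight: the nodes `i` whose simple coroot `h_i` satisfies `μ (h_i) ≠ 0`. -/
def weightSupport (b : P.Base) (μ : M) : Set b.support :=
  {i | P.toLinearMap μ (P.coroot i) ≠ 0}

/-- Dominant integral weights: `μ (h_i)` is a nonnegative integer for every node `i`. -/
def IsDominantIntegral (b : P.Base) (μ : M) : Prop :=
  ∀ i : b.support, ∃ m : ℕ, P.toLinearMap μ (P.coroot i) = m

/-- The nodes `i` such that the simple root `α_i` occurs in `η` with a nonzero coefficient. -/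
def rootSupport [P.IsRootSystem] (b : P.Base) (η : M) : Set b.support :=
  {i | b.toWeightBasis.repr η i ≠ 0}

/-- The ways of writing `η` as a sum of positive roots each of which meets the support of `μ`:
multiplicity functions `ξ` on the roots, vanishing outside the positive roots, with
`∑ α, ξ α • α = η`, such that the root support of each `α` with `ξ α ≠ 0` meets the support
of `μ`. -/
def restrictedPartitions [Fintype ι] [P.IsRootSystem] [P.IsCrystallographic]
    (b : P.Base) (μ η : M) : Set (ι → ℕ) :=
  {ξ | ∑ α, ξ α • P.root α = η ∧
    ∀ α, ξ α ≠ 0 → b.IsPos α ∧ (b.rootSupport (P.root α) ∩ b.weightSupport μ).Nonempty}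

end RootPairing.Base

/-- `V` is an irreducible module of highest weight `μ`, i.e. a copy of `V(μ)`: it is irreducible
and contains a nonzero vector of weight `μ` killed by all positive root spaces. -/
def IsIrreducibleOfHighestWeight {𝔤 : Type*} [LieRing 𝔤] [LieAlgebra ℂ 𝔤] [FiniteDimensional ℂ 𝔤]
    [LieAlgebra.IsKilling ℂ 𝔤] {H : LieSubalgebra ℂ 𝔤} [H.IsCartanSubalgebra]
    (b : (LieAlgebra.IsKilling.rootSystem H).Base) (μ : Dual ℂ H)
    (V : Type*) [AddCommGroup V] [Module ℂ V] [LieRingModule 𝔤 V] [LieModule ℂ 𝔤 V] : Prop :=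
  LieModule.IsIrreducible ℂ 𝔤 V ∧
  ∃ v : V, v ≠ 0 ∧ (∀ h : H, ⁅(h : 𝔤), v⁆ = μ h • v) ∧
    ∀ α : H.root, b.IsPos α → ∀ x ∈ LieAlgebra.rootSpace H (α : H → ℂ), ⁅x, v⁆ = 0

end

/-!
Both sides of the dimension formula are compared with the number of partitions of the node set `J`
into connected blocks each of which meets the support of the highest weight.

*Restricted partitions.* In a partition of `ϑ_J` into positive roots all multiplicities and all
coefficients of the roots involved are at most one. The positive roots with coefficients `0` and
`1` are the sums `ϑ_K` over nonempty connected sets `K` of nodes, so a restricted partition is the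
same as a partition of `J` into connected blocks meeting the support
(`ncard_restrictedPartitions_theta`). Since the Dynkin diagram is a forest, such partitions are
counted by removing leaves: if a leaf `ℓ` with neighbour `k` is removed from `J`, the number does
not change when `ℓ` is not in the support `S`, and it is the sum of the numbers for `S` and for
`S ∪ {k}` when it is (`IsLeaf.ncard_of_notMem`, `IsLeaf.ncard_of_mem`). The explicit counts also
come from this recursion.

*Weight multiplicity.* With a highest weight vector `v`, the weight space of weight `μ - ϑ_J` is
spanned by the vectors obtained by applying the negative simple root vectors `f_j`, `j ∈ J`, to `v`,
each once, in all orders. As no weight below `μ` has a singular vector, elements of this space are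
determined by what the products of the positive simple root vectors `e_j`, `j ∈ J`, in all orders,
make of them. Hence the multiplicity is the rank of the Gram matrix with rows and columns indexed by
the orderings of `J`. Moving `e_i` past the `f_j` shows that its entry at `(σ, τ)` is the product
over `i ∈ J` of `μ(h_i) + ∑ j, -α_j(h_i) [j comes after i in σ and in τ]`. Expanding the product
writes the matrix as a sum of rank one matrices `Φ_p Φ_pᵀ` with nonnegative weights, where `p` runs
over the ways to choose for every `i` either nothing or a neighbour `j` of `i`, its parent, and
`Φ_p` is the indicator function of the orderings with parents after children. By nonnegativity the
rank is the dimension of the span of those `Φ_p` whose weight is not zero, that is, of the functions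
of the rooted forests on `J` whose roots lie in the support of `μ`
(`span_range_sum_weighted_squares`, `nonempty_loweredSpan_equiv`). This dimension satisfies the same
recursion under the removal of a leaf: restricting to the orderings with `ℓ` before `k` and to those
with `ℓ` after `k` splits the span into the spans for `J \ {ℓ}` belonging to `S` and, if `ℓ ∈ S`,
to `S ∪ {k}` (`IsLeaf.forestSpan_eq`, `finrank_forestSpan`).
-/

/-! ### Connected vertex sets and leaves -/

namespace SimpleGraph

variable {I : Type*} {G : SimpleGraph I} {J K K₁ K₂ : Finset I} {S : Set I}
  {x ℓ k : I}

/-- Connectedness of a finite vertex set in terms of cuts: every nonempty proper part of `K` is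
joined by an edge to the rest of `K`. The empty set is allowed. -/
def CutConnected (G : SimpleGraph I) (K : Finset I) : Prop :=
  ∀ A ⊆ K, A.Nonempty → A ≠ K → ∃ a ∈ A, ∃ b ∈ K, b ∉ A ∧ G.Adj a b

/-- `ℓ` is a leaf of `J` whose only neighbour in `J` is `k`. -/
structure IsLeaf (G : SimpleGraph I) (J : Finset I) (ℓ k : I) : Prop where
  mem : ℓ ∈ J
  nbr_mem : k ∈ J
  adj : G.Adj ℓ k
  unique : ∀ j ∈ J, G.Adj ℓ j → j = k

/-- Every nonempty finite vertex set has a vertex with at most one neighbour in the set. For finite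
graphs this is acyclicity, in the form in which inductions on forests use it. -/
def HasLeaves (G : SimpleGraph I) : Prop :=
  ∀ K : Finset I, K.Nonempty → ∃ i ∈ K, ∀ j ∈ K, ∀ j' ∈ K, G.Adj i j → G.Adj i j' → j = j'

theorem cutConnected_iff : G.CutConnected K ↔ (G.induce (K : Set I)).Preconnected := by
  classical
  constructor
  · intro h u v
    by_contra huv
    let A : Finset I := K.filter fun i ↦ ∃ hi : i ∈ K, (G.induce (K : Set I)).Reachable u ⟨i, hi⟩
    obtain ⟨a, ha, b, hb, hbA, hab⟩ := h A (Finset.filter_subset _ _)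
      ⟨u, by simp [A]⟩ (by
        intro hA
        have hv : (v : I) ∈ A := by rw [hA]; exact v.2
        exact huv (Finset.mem_filter.mp hv).2.choose_spec)
    simp only [A, Finset.mem_filter, not_and, not_exists] at ha hbA
    obtain ⟨-, haK, har⟩ := ha
    refine hbA hb hb (har.trans (Adj.reachable ?_))
    simpa using hab
  · intro h A hAK ⟨a, ha⟩ hne
    obtain ⟨b, hb, hbA⟩ : ∃ b ∈ K, b ∉ A := by
      by_contra! hc
      exact hne (Finset.Subset.antisymm hAK hc)
    obtain ⟨p⟩ := h ⟨a, hAK ha⟩ ⟨b, hb⟩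
    obtain ⟨d, -, h1, h2⟩ := p.exists_boundary_dart {i | (i : I) ∈ A} ha hbA
    exact ⟨d.fst, h1, d.snd, d.snd.2, h2, by simpa using d.adj⟩

theorem cutConnected_empty : G.CutConnected ∅ := by
  intro A hA hne
  simp_all

theorem cutConnected_singleton : G.CutConnected {x} := by
  intro A hA hne hne'
  rcases Finset.subset_singleton_iff.mp hA with rfl | rfl <;> simp_all

theorem CutConnected.exists_adj (hK : G.CutConnected K) (hx : x ∈ K) (hne : K ≠ {x}) :
    ∃ y ∈ K, G.Adj x y := by
  obtain ⟨a, ha, b, hb, -, hab⟩ := hK {x} (by simpa using hx) (by simp) hne.symm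
  obtain rfl := Finset.mem_singleton.mp ha
  exact ⟨b, hb, hab⟩

namespace IsLeaf

theorem ne (h : G.IsLeaf J ℓ k) : ℓ ≠ k := h.adj.ne

theorem subsingleton (h : G.IsLeaf J ℓ k) (hK : K ⊆ J) :
    ∀ j ∈ K, ∀ j' ∈ K, G.Adj ℓ j → G.Adj ℓ j' → j = j' := fun j hj j' hj' h1 h2 ↦
  (h.unique j (hK hj) h1).trans (h.unique j' (hK hj') h2).symm

theorem nbr_mem_of_cutConnected (h : G.IsLeaf J ℓ k) (hKJ : K ⊆ J) (hK : G.CutConnected K)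
    (hℓ : ℓ ∈ K) (hne : K ≠ {ℓ}) : k ∈ K := by
  obtain ⟨y, hy, hadj⟩ := hK.exists_adj hℓ hne
  exact h.unique y (hKJ hy) hadj ▸ hy

end IsLeaf

variable [DecidableEq I]

/-- Removing a vertex with at most one neighbour from a connected set keeps it connected. -/
theorem CutConnected.erase (hK : G.CutConnected K)
    (huniq : ∀ j ∈ K, ∀ j' ∈ K, G.Adj x j → G.Adj x j' → j = j') :
    G.CutConnected (K.erase x) := by
  intro A hA hne hne'
  by_cases hx : x ∈ K
  swap
  · rw [Finset.erase_eq_of_notMem hx] at hA hne' ⊢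
    exact hK A hA hne hne'
  have hxA : x ∉ A := fun h ↦ by simpa using hA h
  have hAK : A ⊆ K := hA.trans (Finset.erase_subset _ _)
  -- The neighbour of `x`, if it exists, decides on which side of the cut `x` is put.
  by_cases hnb : ∃ y ∈ A, G.Adj x y
  · obtain ⟨y, hyA, hxy⟩ := hnb
    obtain ⟨a, ha, b, hb, hbA, hab⟩ := hK (insert x A)
      (Finset.insert_subset hx hAK) (by simp) (by
        rintro rfl
        exact hne' (by simp [hxA]))
    rw [Finset.mem_insert, not_or] at hbA
    rcases Finset.mem_insert.mp ha with rfl | ha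
    · exact absurd (huniq b hb y (hAK hyA) hab hxy ▸ hyA) hbA.2
    · exact ⟨a, ha, b, Finset.mem_erase.mpr ⟨hbA.1, hb⟩, hbA.2, hab⟩
  · obtain ⟨a, ha, b, hb, hbA, hab⟩ := hK A hAK hne (by rintro rfl; exact hxA hx)
    refine ⟨a, ha, b, Finset.mem_erase.mpr ⟨?_, hb⟩, hbA, hab⟩
    rintro rfl
    exact hnb ⟨a, ha, hab.symm⟩

theorem CutConnected.insert (hK : G.CutConnected K) (hk : k ∈ K) (hadj : G.Adj ℓ k) :
    G.CutConnected (insert ℓ K) := by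
  intro A hA hne hne'
  by_cases hAℓ : A = {ℓ}
  · by_cases hkl : k = ℓ
    · exact absurd (hkl ▸ hadj) (G.loopless.irrefl _)
    · exact ⟨ℓ, by simp [hAℓ], k, by simp [hk], by simp [hAℓ, hkl], hadj⟩
  have hsub : A.erase ℓ ⊆ K := by grind
  have hne1 : (A.erase ℓ).Nonempty := by
    obtain ⟨a, ha⟩ := hne
    by_contra! h
    rw [Finset.erase_eq_empty_iff] at h
    rcases h with rfl | h
    · simp at ha
    · exact hAℓ h
  by_cases hAK : A.erase ℓ = K
  · have hℓ : ℓ ∉ A := by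
      intro hℓ
      apply hne'
      rw [← hAK, Finset.insert_erase hℓ]
    rw [Finset.erase_eq_of_notMem hℓ] at hAK
    exact ⟨k, hAK ▸ hk, ℓ, by simp, hℓ, hadj.symm⟩
  · obtain ⟨a, ha, b, hb, hbA, hab⟩ := hK _ hsub hne1 hAK
    by_cases hbℓ : b = ℓ
    · subst hbℓ
      have haA := Finset.mem_of_mem_erase ha
      by_cases hbA' : b ∈ A
      · -- Here `ℓ ∈ K`, and the cut is repeated with `ℓ` added to it.
        obtain ⟨a', ha', b', hb', hbA'', hab'⟩ := hK A
          (by intro z hz; by_cases hzb : z = b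
              · exact hzb ▸ hb
              · exact hsub (Finset.mem_erase.mpr ⟨hzb, hz⟩)) hne
          (by rintro rfl; exact hne' (by simp [hb]))
        exact ⟨a', ha', b', by simp [hb'], hbA'', hab'⟩
      · exact ⟨a, haA, b, by simp, hbA', hab⟩
    · exact ⟨a, Finset.mem_of_mem_erase ha, b, by simp [hb],
        fun h ↦ hbA (Finset.mem_erase.mpr ⟨hbℓ, h⟩), hab⟩

theorem IsLeaf.nbr_mem_erase (h : G.IsLeaf J ℓ k) : k ∈ J.erase ℓ :=
  Finset.mem_erase.mpr ⟨h.ne.symm, h.nbr_mem⟩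

theorem IsLeaf.cutConnected_erase (h : G.IsLeaf J ℓ k) (hJ : G.CutConnected J) :
    G.CutConnected (J.erase ℓ) :=
  hJ.erase (h.subsingleton subset_rfl)

theorem HasLeaves.exists_isLeaf (hG : G.HasLeaves) (hJ : G.CutConnected J) (hne : J.Nonempty) :
    (∃ i, J = {i}) ∨ ∃ ℓ k, G.IsLeaf J ℓ k := by
  obtain ⟨i, hi, huniq⟩ := hG J hne
  by_cases h : J = {i}
  · exact Or.inl ⟨i, h⟩
  · obtain ⟨k, hk, hadj⟩ := hJ.exists_adj hi h
    exact Or.inr ⟨i, k, hi, hk, hadj, fun j hj hij ↦ huniq j hj k hk hij hadj⟩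

/-- Induction on connected sets of a forest by removing leaves. -/
theorem CutConnected.leaf_induction (hG : G.HasLeaves) {P : Finset I → Prop} (h0 : P ∅)
    (h1 : ∀ i, P {i})
    (hs : ∀ J ℓ k, G.CutConnected J → G.IsLeaf J ℓ k → P (J.erase ℓ) → P J)
    (hJ : G.CutConnected J) : P J := by
  induction hn : J.card generalizing J with
  | zero => rwa [Finset.card_eq_zero.mp hn]
  | succ n ih =>
    rcases hG.exists_isLeaf hJ (Finset.card_pos.mp (by omega)) with ⟨i, rfl⟩ | ⟨ℓ, k, h⟩
    · exact h1 i
    · exact hs J ℓ k hJ h (ih (h.cutConnected_erase hJ) (by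
        rw [Finset.card_erase_of_mem h.mem, hn, Nat.add_sub_cancel]))

/-- In a forest, the intersection of two connected sets is connected. -/
theorem CutConnected.inter (hG : G.HasLeaves) (h₁ : G.CutConnected K₁)
    (h₂ : G.CutConnected K₂) : G.CutConnected (K₁ ∩ K₂) := by
  induction hn : (K₁ ∪ K₂).card generalizing K₁ K₂ with
  | zero =>
    rw [Finset.card_eq_zero, Finset.union_eq_empty] at hn
    simpa [hn.1] using cutConnected_empty
  | succ n ih =>
    obtain ⟨x, hx, hu⟩ := hG (K₁ ∪ K₂) (Finset.card_pos.mp (by omega))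
    have hc : (K₁.erase x ∪ K₂.erase x).card = n := by
      rw [← Finset.erase_union_distrib, Finset.card_erase_of_mem hx, hn, Nat.add_sub_cancel]
    have hu₁ : ∀ j ∈ K₁, ∀ j' ∈ K₁, G.Adj x j → G.Adj x j' → j = j' := fun j hj j' hj' ↦
      hu j (Finset.mem_union_left _ hj) j' (Finset.mem_union_left _ hj')
    have hu₂ : ∀ j ∈ K₂, ∀ j' ∈ K₂, G.Adj x j → G.Adj x j' → j = j' := fun j hj j' hj' ↦
      hu j (Finset.mem_union_right _ hj) j' (Finset.mem_union_right _ hj')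
    have IH := ih (h₁.erase hu₁) (h₂.erase hu₂) hc
    have he : K₁.erase x ∩ K₂.erase x = (K₁ ∩ K₂).erase x := by
      ext z
      simp only [Finset.mem_inter, Finset.mem_erase]
      tauto
    rw [he] at IH
    by_cases hxi : x ∈ K₁ ∩ K₂
    · obtain ⟨hx₁, hx₂⟩ := Finset.mem_inter.mp hxi
      by_cases e₁ : K₁ = {x}
      · rw [e₁, Finset.singleton_inter_of_mem hx₂]; exact cutConnected_singleton
      by_cases e₂ : K₂ = {x}
      · rw [e₂, Finset.inter_singleton_of_mem hx₁]; exact cutConnected_singleton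
      obtain ⟨y, hy, hxy⟩ := h₁.exists_adj hx₁ e₁
      obtain ⟨y', hy', hxy'⟩ := h₂.exists_adj hx₂ e₂
      obtain rfl := hu y (Finset.mem_union_left _ hy) y' (Finset.mem_union_right _ hy') hxy hxy'
      have := IH.insert (Finset.mem_erase.mpr ⟨hxy.ne.symm, Finset.mem_inter.mpr ⟨hy, hy'⟩⟩) hxy
      rwa [Finset.insert_erase hxi] at this
    · rwa [Finset.erase_eq_of_notMem hxi] at IH

end SimpleGraph

/-! ### Partitions into connected blocks meeting a given set -/

namespace SimpleGraph

variable {I : Type*} {G : SimpleGraph I} {J K : Finset I} {S : Set I} {x ℓ k : I}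

/-- `π` is a partition of `J` into connected blocks, each of which meets `S`. -/
structure IsConnectedPartition (G : SimpleGraph I) (S : Set I) (J : Finset I)
    (π : Finset (Finset I)) : Prop where
  subset : ∀ K ∈ π, K ⊆ J
  conn : ∀ K ∈ π, G.CutConnected K
  meets : ∀ K ∈ π, ∃ s ∈ K, s ∈ S
  cover : ∀ x ∈ J, ∃ K ∈ π, x ∈ K
  eq_of_mem : ∀ K ∈ π, ∀ K' ∈ π, ∀ x, x ∈ K → x ∈ K' → K = K'

/-- The partitions of `J` into connected blocks which all meet `S`. -/
def connectedPartitions (G : SimpleGraph I) (S : Set I) (J : Finset I) :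
    Set (Finset (Finset I)) :=
  {π | G.IsConnectedPartition S J π}

theorem finite_connectedPartitions : (G.connectedPartitions S J).Finite :=
  J.powerset.powerset.finite_toSet.subset fun π hπ ↦ by
    simp only [Finset.mem_coe, Finset.mem_powerset]
    exact fun K hK ↦ Finset.mem_powerset.mpr (hπ.subset K hK)

theorem ncard_connectedPartitions_empty : (G.connectedPartitions S ∅).ncard = 1 := by
  rw [Set.ncard_eq_one]
  refine ⟨∅, Set.eq_singleton_iff_unique_mem.mpr ⟨⟨by simp, by simp, by simp, by simp, by simp⟩,
    fun π hπ ↦ Finset.eq_empty_of_forall_notMem fun K hK ↦ ?_⟩⟩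
  obtain ⟨s, hs, -⟩ := hπ.meets K hK
  simpa using hπ.subset K hK hs

theorem ncard_connectedPartitions_of_disjoint (hJ : J.Nonempty) (hS : ∀ s ∈ J, s ∉ S) :
    (G.connectedPartitions S J).ncard = 0 := by
  rw [Set.ncard_eq_zero finite_connectedPartitions]
  refine Set.eq_empty_of_forall_notMem fun π hπ ↦ ?_
  obtain ⟨x, hx⟩ := hJ
  obtain ⟨K, hK, -⟩ := hπ.cover x hx
  obtain ⟨s, hs, hsS⟩ := hπ.meets K hK
  exact hS s (hπ.subset K hK hs) hsS

/-- If `S` meets `J` in a single point, then the only partition is the one with the single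
block `J`. -/
theorem ncard_connectedPartitions_of_unique (hJ : G.CutConnected J) (hx : x ∈ J)
    (hS : ∀ s ∈ J, s ∈ S ↔ s = x) : (G.connectedPartitions S J).ncard = 1 := by
  rw [Set.ncard_eq_one]
  refine ⟨{J}, Set.eq_singleton_iff_unique_mem.mpr ⟨⟨by simp, by simpa using hJ,
    by simpa using ⟨x, hx, (hS x hx).mpr rfl⟩, by simp, by simp⟩, fun π hπ ↦ ?_⟩⟩
  have hmem : ∀ K ∈ π, x ∈ K := fun K hK ↦ by
    obtain ⟨s, hs, hsS⟩ := hπ.meets K hK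
    exact (hS s (hπ.subset K hK hs)).mp hsS ▸ hs
  have hall : ∀ K ∈ π, K = J := fun K hK ↦ by
    refine (hπ.subset K hK).antisymm fun y hy ↦ ?_
    obtain ⟨K', hK', hy'⟩ := hπ.cover y hy
    rwa [hπ.eq_of_mem K hK K' hK' x (hmem K hK) (hmem K' hK')]
  obtain ⟨K, hK, -⟩ := hπ.cover x hx
  exact Finset.eq_singleton_iff_unique_mem.mpr ⟨hall K hK ▸ hK, hall⟩

variable [DecidableEq I]

/-- Partitions in which the leaf `ℓ` is a block of its own. -/
theorem IsLeaf.ncard_singleton_mem (h : G.IsLeaf J ℓ k) (hℓS : ℓ ∈ S) :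
    {π ∈ G.connectedPartitions S J | {ℓ} ∈ π}.ncard =
      (G.connectedPartitions S (J.erase ℓ)).ncard := by
  have hnot : ∀ π ∈ G.connectedPartitions S (J.erase ℓ), {ℓ} ∉ π := fun π hπ hmem ↦ by
    simpa using hπ.subset _ hmem
  trans ((fun π ↦ insert {ℓ} π) '' G.connectedPartitions S (J.erase ℓ)).ncard
  · congr 1
    ext π
    simp only [Set.mem_sep_iff, Set.mem_image]
    constructor
    · rintro ⟨hπ, hℓ⟩
      refine ⟨π.erase {ℓ}, ⟨fun K hK x hx ↦ ?_, fun K hK ↦ hπ.conn K (Finset.mem_of_mem_erase hK),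
        fun K hK ↦ hπ.meets K (Finset.mem_of_mem_erase hK), fun x hx ↦ ?_,
        fun K hK K' hK' ↦ hπ.eq_of_mem K (Finset.mem_of_mem_erase hK) K'
          (Finset.mem_of_mem_erase hK')⟩, Finset.insert_erase hℓ⟩
      · rw [Finset.mem_erase] at hK ⊢
        refine ⟨?_, hπ.subset K hK.2 hx⟩
        rintro rfl
        exact hK.1 (hπ.eq_of_mem K hK.2 _ hℓ x hx (by simp))
      · rw [Finset.mem_erase] at hx
        obtain ⟨K, hK, hxK⟩ := hπ.cover x hx.2
        refine ⟨K, Finset.mem_erase.mpr ⟨?_, hK⟩, hxK⟩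
        rintro rfl
        exact hx.1 (by simpa using hxK)
    · rintro ⟨π, hπ, rfl⟩
      refine ⟨⟨?_, ?_, ?_, fun x hx ↦ ?_, ?_⟩, by simp⟩
      · simpa using ⟨h.mem, fun K hK ↦ (hπ.subset K hK).trans (Finset.erase_subset _ _)⟩
      · simpa using ⟨cutConnected_singleton, hπ.conn⟩
      · simpa using ⟨hℓS, hπ.meets⟩
      · by_cases hxℓ : x = ℓ
        · exact ⟨{ℓ}, by simp, by simp [hxℓ]⟩
        · obtain ⟨K, hK, hxK⟩ := hπ.cover x (Finset.mem_erase.mpr ⟨hxℓ, hx⟩)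
          exact ⟨K, by simp [hK], hxK⟩
      · have hℓK : ∀ K ∈ π, ℓ ∉ K := fun K hK hmem ↦ by simpa using hπ.subset K hK hmem
        intro K hK K' hK' x hx hx'
        rw [Finset.mem_insert] at hK hK'
        rcases hK with rfl | hK <;> rcases hK' with rfl | hK'
        · rfl
        · rw [Finset.mem_singleton] at hx
          exact absurd (hx ▸ hx') (hℓK K' hK')
        · rw [Finset.mem_singleton] at hx'
          exact absurd (hx' ▸ hx) (hℓK K hK)
        · exact hπ.eq_of_mem K hK K' hK' x hx hx'
  · refine Set.InjOn.ncard_image fun π hπ π' hπ' heq ↦ ?_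
    rw [← Finset.erase_insert (hnot π hπ), heq, Finset.erase_insert (hnot π' hπ')]

/-- Partitions in which the leaf `ℓ` shares its block with its neighbour `k`: dropping `ℓ` from its
block gives a partition of the remaining set, in which the block of `k` is exempt from meeting `S`
when `ℓ ∈ S`. -/
theorem IsLeaf.ncard_singleton_notMem (h : G.IsLeaf J ℓ k) {S' : Set I}
    (hS' : ∀ s, s ∈ S' ↔ s ∈ S ∨ (s = k ∧ ℓ ∈ S)) :
    {π ∈ G.connectedPartitions S J | {ℓ} ∉ π}.ncard =
      (G.connectedPartitions S' (J.erase ℓ)).ncard := by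
  set g : Finset I → Finset I := fun K ↦ if k ∈ K then insert ℓ K else K with hg
  have hkℓ := h.ne.symm
  have hgmem : ∀ K x, x ≠ ℓ → (x ∈ g K ↔ x ∈ K) := fun K x hx ↦ by
    by_cases hk : k ∈ K <;> simp [hg, hk, hx]
  have hgℓ : ∀ K, ℓ ∉ K → (ℓ ∈ g K ↔ k ∈ K) := fun K hK ↦ by
    by_cases hk : k ∈ K <;> simp [hg, hk, hK]
  have hger : ∀ K, ℓ ∉ K → (g K).erase ℓ = K := fun K hK ↦ by
    by_cases hk : k ∈ K <;> simp [hg, hk, hK]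
  have hℓK : ∀ π ∈ G.connectedPartitions S' (J.erase ℓ), ∀ K ∈ π, ℓ ∉ K := fun π hπ K hK hmem ↦ by
    simpa using hπ.subset K hK hmem
  trans ((fun π ↦ π.image g) '' G.connectedPartitions S' (J.erase ℓ)).ncard
  · congr 1
    ext π
    simp only [Set.mem_sep_iff, Set.mem_image]
    constructor
    · rintro ⟨hπ, hℓ⟩
      have hkK : ∀ K ∈ π, ℓ ∈ K → k ∈ K := fun K hK hmem ↦
        h.nbr_mem_of_cutConnected (hπ.subset K hK) (hπ.conn K hK) hmem
          (by rintro rfl; exact hℓ hK)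
      have hKk : ∀ K ∈ π, k ∈ K → ℓ ∈ K := fun K hK hmem ↦ by
        obtain ⟨K', hK', hℓ'⟩ := hπ.cover ℓ h.mem
        rwa [hπ.eq_of_mem K hK K' hK' k hmem (hkK K' hK' hℓ')]
      refine ⟨π.image (·.erase ℓ), ⟨?_, ?_, ?_, ?_, ?_⟩, ?_⟩
      · simpa using fun K hK ↦ Finset.erase_subset_erase ℓ (hπ.subset K hK)
      · simpa using fun K hK ↦ (hπ.conn K hK).erase (h.subsingleton (hπ.subset K hK))
      · simp only [Finset.mem_image, forall_exists_index, and_imp, forall_apply_eq_imp_iff₂]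
        intro K hK
        obtain ⟨s, hs, hsS⟩ := hπ.meets K hK
        by_cases hsℓ : s = ℓ
        · subst hsℓ
          exact ⟨k, Finset.mem_erase.mpr ⟨hkℓ, hkK K hK hs⟩, (hS' k).mpr (Or.inr ⟨rfl, hsS⟩)⟩
        · exact ⟨s, Finset.mem_erase.mpr ⟨hsℓ, hs⟩, (hS' s).mpr (Or.inl hsS)⟩
      · intro x hx
        rw [Finset.mem_erase] at hx
        obtain ⟨K, hK, hxK⟩ := hπ.cover x hx.2
        exact ⟨K.erase ℓ, Finset.mem_image_of_mem _ hK, Finset.mem_erase.mpr ⟨hx.1, hxK⟩⟩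
      · simp only [Finset.mem_image, forall_exists_index, and_imp, forall_apply_eq_imp_iff₂]
        intro K hK K' hK' x hx hx'
        rw [hπ.eq_of_mem K hK K' hK' x (Finset.mem_of_mem_erase hx) (Finset.mem_of_mem_erase hx')]
      · rw [Finset.image_image]
        conv_rhs => rw [← Finset.image_id (s := π)]
        refine Finset.image_congr fun K hK ↦ ?_
        by_cases hk : k ∈ K
        · simp [hg, hk, hkℓ, hKk K hK hk]
        · have hℓK' : ℓ ∉ K := fun hmem ↦ hk (hkK K hK hmem)
          simp [hg, hk, hℓK']
    · rintro ⟨π, hπ, rfl⟩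
      refine ⟨⟨?_, ?_, ?_, ?_, ?_⟩, ?_⟩
      · simp only [Finset.mem_image, forall_exists_index, and_imp, forall_apply_eq_imp_iff₂]
        intro K hK x hx
        by_cases hxℓ : x = ℓ
        · exact hxℓ ▸ h.mem
        · exact Finset.mem_of_mem_erase (hπ.subset K hK ((hgmem K x hxℓ).mp hx))
      · simp only [Finset.mem_image, forall_exists_index, and_imp, forall_apply_eq_imp_iff₂]
        intro K hK
        by_cases hk : k ∈ K
        · simpa [hg, hk] using (hπ.conn K hK).insert hk h.adj
        · simpa [hg, hk] using hπ.conn K hK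
      · simp only [Finset.mem_image, forall_exists_index, and_imp, forall_apply_eq_imp_iff₂]
        intro K hK
        obtain ⟨s, hs, hsS⟩ := hπ.meets K hK
        rcases (hS' s).mp hsS with hsS | ⟨rfl, hℓS⟩
        · refine ⟨s, (hgmem K s ?_).mpr hs, hsS⟩
          rintro rfl
          exact hℓK π hπ K hK hs
        · exact ⟨ℓ, (hgℓ K (hℓK π hπ K hK)).mpr hs, hℓS⟩
      · intro x hx
        by_cases hxℓ : x = ℓ
        · obtain ⟨K, hK, hkK⟩ := hπ.cover k h.nbr_mem_erase
          exact ⟨g K, Finset.mem_image_of_mem _ hK, hxℓ ▸ (hgℓ K (hℓK π hπ K hK)).mpr hkK⟩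
        · obtain ⟨K, hK, hxK⟩ := hπ.cover x (Finset.mem_erase.mpr ⟨hxℓ, hx⟩)
          exact ⟨g K, Finset.mem_image_of_mem _ hK, (hgmem K x hxℓ).mpr hxK⟩
      · simp only [Finset.mem_image, forall_exists_index, and_imp, forall_apply_eq_imp_iff₂]
        intro K hK K' hK' x hx hx'
        by_cases hxℓ : x = ℓ
        · subst hxℓ
          rw [hπ.eq_of_mem K hK K' hK' k ((hgℓ K (hℓK π hπ K hK)).mp hx)
            ((hgℓ K' (hℓK π hπ K' hK')).mp hx')]
        · rw [hπ.eq_of_mem K hK K' hK' x ((hgmem K x hxℓ).mp hx) ((hgmem K' x hxℓ).mp hx')]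
      · simp only [Finset.mem_image, not_exists, not_and]
        intro K hK heq
        obtain ⟨s, hs, -⟩ := hπ.meets K hK
        have hsℓ : s ≠ ℓ := by rintro rfl; exact hℓK π hπ K hK hs
        have := (hgmem K s hsℓ).mpr hs
        rw [heq, Finset.mem_singleton] at this
        exact hsℓ this
  · refine Set.InjOn.ncard_image fun π hπ π' hπ' heq ↦ ?_
    have key : ∀ π ∈ G.connectedPartitions S' (J.erase ℓ), (π.image g).image (·.erase ℓ) = π := by
      intro π hπ
      rw [Finset.image_image]
      conv_rhs => rw [← Finset.image_id (s := π)]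
      exact Finset.image_congr fun K hK ↦ hger K (hℓK π hπ K hK)
    rw [← key π hπ, heq, key π' hπ']

theorem ncard_sep_add_ncard_sep (ℓ : I) : (G.connectedPartitions S J).ncard =
    {π ∈ G.connectedPartitions S J | {ℓ} ∈ π}.ncard +
      {π ∈ G.connectedPartitions S J | {ℓ} ∉ π}.ncard := by
  rw [← Set.ncard_union_eq ?_ (finite_connectedPartitions.subset (Set.sep_subset _ _))
    (finite_connectedPartitions.subset (Set.sep_subset _ _))]
  · congr 1
    ext π
    simp only [Set.mem_union, Set.mem_sep_iff]
    tauto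
  · exact Set.disjoint_left.mpr fun π h1 h2 ↦ h2.2 h1.2

/-- The number of partitions does not change when a leaf outside `S` is removed. -/
theorem IsLeaf.ncard_of_notMem (h : G.IsLeaf J ℓ k) (hℓS : ℓ ∉ S) :
    (G.connectedPartitions S J).ncard = (G.connectedPartitions S (J.erase ℓ)).ncard := by
  rw [ncard_sep_add_ncard_sep ℓ, h.ncard_singleton_notMem (S' := S) (by simp [hℓS])]
  have : {π ∈ G.connectedPartitions S J | {ℓ} ∈ π} = ∅ := by
    refine Set.eq_empty_of_forall_notMem fun π ⟨hπ, hmem⟩ ↦ ?_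
    obtain ⟨s, hs, hsS⟩ := hπ.meets _ hmem
    exact hℓS (Finset.mem_singleton.mp hs ▸ hsS)
  rw [this, Set.ncard_empty, zero_add]

/-- Removing a leaf `ℓ ∈ S` with neighbour `k`: either `ℓ` is a block of its own, or it shares its
block with `k`. -/
theorem IsLeaf.ncard_of_mem (h : G.IsLeaf J ℓ k) (hℓS : ℓ ∈ S) :
    (G.connectedPartitions S J).ncard = (G.connectedPartitions S (J.erase ℓ)).ncard +
      (G.connectedPartitions (insert k S) (J.erase ℓ)).ncard := by
  rw [ncard_sep_add_ncard_sep ℓ, h.ncard_singleton_mem hℓS,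
    h.ncard_singleton_notMem (S' := insert k S) (by simp [hℓS, or_comm])]

end SimpleGraph

/-! ### Counting the partitions -/

namespace SimpleGraph

variable {I : Type*} {G : SimpleGraph I} {J K : Finset I} {S : Set I} {x ℓ k s t : I}

theorem mem_sInter_preconnected_iff [Finite I] {T : Set I} :
    x ∈ ⋂₀ {K : Set I | T ⊆ K ∧ (G.induce K).Preconnected} ↔
      ∀ K : Finset I, T ⊆ K → G.CutConnected K → x ∈ K := by
  classical
  refine ⟨fun h K hT hK ↦ h K ⟨hT, cutConnected_iff.mp hK⟩, fun h K hK ↦ ?_⟩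
  lift K to Finset I using Set.toFinite K
  exact h K hK.1 (cutConnected_iff.mpr hK.2)

section

variable [DecidableEq I]

/-- In a forest, the smallest connected set containing a leaf `ℓ` of the connected set `J` and
another point `t` of `J` arises by adding `ℓ` to the one for `t` and the neighbour of `ℓ`. -/
theorem IsLeaf.sInter_preconnected_pair [Finite I] (hG : G.HasLeaves) (h : G.IsLeaf J ℓ k)
    (hJ : G.CutConnected J) (ht : t ∈ J) (htℓ : t ≠ ℓ) :
    (⋂₀ {K : Set I | {ℓ, t} ⊆ K ∧ (G.induce K).Preconnected}).ncard =
      (⋂₀ {K : Set I | {k, t} ⊆ K ∧ (G.induce K).Preconnected}).ncard + 1 := by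
  have hnot : ℓ ∉ ⋂₀ {K : Set I | {k, t} ⊆ K ∧ (G.induce K).Preconnected} := by
    rw [mem_sInter_preconnected_iff]
    intro hall
    have := hall (J.erase ℓ) ?_ (h.cutConnected_erase hJ)
    · simp at this
    · simp [Set.insert_subset_iff, h.nbr_mem, h.ne.symm, ht, htℓ]
  rw [← Set.ncard_insert_of_notMem hnot (Set.toFinite _)]
  congr 1
  ext x
  rw [Set.mem_insert_iff, mem_sInter_preconnected_iff, mem_sInter_preconnected_iff]
  constructor
  · intro hx
    by_cases hxℓ : x = ℓ
    · exact Or.inl hxℓ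
    · refine Or.inr fun K hK hKc ↦ ?_
      simp only [Set.insert_subset_iff, Set.singleton_subset_iff, Finset.mem_coe] at hK
      have := hx (insert ℓ K) (by simp [Set.insert_subset_iff, hK.2]) (hKc.insert hK.1 h.adj)
      exact Finset.mem_of_mem_insert_of_ne this hxℓ
  · intro hx K hK hKc
    simp only [Set.insert_subset_iff, Set.singleton_subset_iff, Finset.mem_coe] at hK
    rcases hx with rfl | hx
    · exact hK.1
    · refine hx K ?_ hKc
      have hkK : k ∈ K ∩ J := by
        refine h.nbr_mem_of_cutConnected Finset.inter_subset_right (hKc.inter hG hJ)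
          (Finset.mem_inter.mpr ⟨hK.1, h.mem⟩) fun heq ↦ htℓ ?_
        have : t ∈ K ∩ J := Finset.mem_inter.mpr ⟨hK.2, ht⟩
        rwa [heq, Finset.mem_singleton] at this
      simp [Set.insert_subset_iff, (Finset.mem_inter.mp hkK).1, hK.2]

/-- If `S` meets the connected set `J` exactly in `s` and `t`, possibly equal, then the partitions
are counted by the points of the smallest connected set containing `s` and `t`. -/
theorem ncard_connectedPartitions_of_pair [Finite I] (hG : G.HasLeaves) (hJ : G.CutConnected J)
    (hs : s ∈ J) (ht : t ∈ J) (hS : ∀ x ∈ J, x ∈ S ↔ x = s ∨ x = t) :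
    (G.connectedPartitions S J).ncard =
      (⋂₀ {K : Set I | {s, t} ⊆ K ∧ (G.induce K).Preconnected}).ncard := by
  have hself (J : Finset I) (hJ : G.CutConnected J) (s : I) (hs : s ∈ J) (S : Set I)
      (hS : ∀ x ∈ J, x ∈ S ↔ x = s ∨ x = s) : (G.connectedPartitions S J).ncard =
      (⋂₀ {K : Set I | {s, s} ⊆ K ∧ (G.induce K).Preconnected}).ncard := by
    rw [ncard_connectedPartitions_of_unique hJ hs (by simpa using hS), eq_comm, Set.ncard_eq_one]
    refine ⟨s, Set.eq_singleton_iff_unique_mem.mpr ⟨fun K hK ↦ hK.1 (by simp), fun x hx ↦ ?_⟩⟩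
    rw [mem_sInter_preconnected_iff] at hx
    simpa using hx {s} (by simp) cutConnected_singleton
  refine hJ.leaf_induction hG (P := fun J ↦ ∀ (S : Set I) (s t : I), G.CutConnected J → s ∈ J →
    t ∈ J → (∀ x ∈ J, x ∈ S ↔ x = s ∨ x = t) → (G.connectedPartitions S J).ncard =
      (⋂₀ {K : Set I | {s, t} ⊆ K ∧ (G.induce K).Preconnected}).ncard) ?_ ?_ ?_ S s t hJ hs ht hS
  · intro S s t _ hs
    simp at hs
  · intro i S s t hJ hs ht hS
    obtain rfl := Finset.mem_singleton.mp hs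
    obtain rfl := Finset.mem_singleton.mp ht
    exact hself _ hJ t hs S hS
  · intro J ℓ k hJ h IH S s t _ hs ht hS
    have hJ' := h.cutConnected_erase hJ
    by_cases hst : s = t
    · subst hst
      exact hself _ hJ s hs S hS
    -- The case that the leaf is the first of the two points.
    have main : ∀ t ∈ J, t ≠ ℓ → (∀ x ∈ J, x ∈ S ↔ x = ℓ ∨ x = t) →
        (G.connectedPartitions S J).ncard =
        (⋂₀ {K : Set I | {ℓ, t} ⊆ K ∧ (G.induce K).Preconnected}).ncard := by
      intro t ht htℓ hS
      have ht' : t ∈ J.erase ℓ := Finset.mem_erase.mpr ⟨htℓ, ht⟩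
      rw [h.sInter_preconnected_pair hG hJ ht htℓ, h.ncard_of_mem ((hS ℓ h.mem).mpr (Or.inl rfl)),
        ncard_connectedPartitions_of_unique hJ' ht' (fun x hx ↦ ?_),
        IH _ k t hJ' h.nbr_mem_erase ht' (fun x hx ↦ ?_), add_comm]
      · rw [Finset.mem_erase] at hx
        simp [hS x hx.2, hx.1]
      · rw [Finset.mem_erase] at hx
        simp [hS x hx.2, hx.1]
    by_cases hsℓ : s = ℓ
    · subst hsℓ
      exact main t ht (Ne.symm hst) hS
    by_cases htℓ : t = ℓ
    · subst htℓ
      rw [Set.pair_comm]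
      exact main s hs hst fun x hx ↦ (hS x hx).trans or_comm
    · rw [h.ncard_of_notMem (by rw [hS ℓ h.mem]; tauto)]
      exact IH S s t hJ' (Finset.mem_erase.mpr ⟨hsℓ, hs⟩) (Finset.mem_erase.mpr ⟨htℓ, ht⟩)
        fun x hx ↦ hS x (Finset.mem_of_mem_erase hx)

/-- A leaf of a set of labelled vertices. -/
theorem isLeaf_image {f : ℕ → I} {A : Finset ℕ} {r : ℕ → ℕ → Prop} {a c : ℕ}
    (hadj : ∀ a ∈ A, ∀ b ∈ A, G.Adj (f a) (f b) ↔ r a b) (ha : a ∈ A) (hc : c ∈ A) (hac : r a c)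
    (huniq : ∀ b ∈ A, r a b → b = c) : G.IsLeaf (A.image f) (f a) (f c) where
  mem := Finset.mem_image_of_mem f ha
  nbr_mem := Finset.mem_image_of_mem f hc
  adj := (hadj a ha c hc).mpr hac
  unique := by
    simp only [Finset.mem_image, forall_exists_index, and_imp, forall_apply_eq_imp_iff₂]
    intro b hb hab
    rw [huniq b hb ((hadj a ha b hb).mp hab)]

theorem image_erase_of_injOn {f : ℕ → I} {A B : Finset ℕ} {a : ℕ}
    (hf : Set.InjOn f A) (ha : a ∈ A) (hB : ∀ b, b ∈ B ↔ b ≠ a ∧ b ∈ A) :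
    (A.image f).erase (f a) = B.image f := by
  ext x
  simp only [Finset.mem_erase, Finset.mem_image, hB]
  constructor
  · rintro ⟨hx, b, hb, rfl⟩
    exact ⟨b, ⟨fun h ↦ hx (h ▸ rfl), hb⟩, rfl⟩
  · rintro ⟨b, ⟨hba, hb⟩, rfl⟩
    exact ⟨fun h ↦ hba (hf hb ha h), b, hb, rfl⟩

/-- A path with `m + 1` vertices has `m + 1` connected partitions meeting its two ends: the trivial
one, and one for each edge. -/
theorem ncard_connectedPartitions_path (m : ℕ) (f : ℕ → I)
    (hf : ∀ a ≤ m, ∀ b ≤ m, f a = f b → a = b)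
    (hadj : ∀ a ≤ m, ∀ b ≤ m, G.Adj (f a) (f b) ↔ a + 1 = b ∨ b + 1 = a)
    (hJ : J = (Finset.range (m + 1)).image f) (hS : ∀ a ≤ m, f a ∈ S ↔ a = 0 ∨ a = m) :
    G.CutConnected J ∧ (G.connectedPartitions S J).ncard = m + 1 := by
  subst hJ
  induction m generalizing f S with
  | zero =>
    refine ⟨by simpa using cutConnected_singleton, ?_⟩
    refine ncard_connectedPartitions_of_unique (by simpa using cutConnected_singleton)
      (x := f 0) (by simp) ?_
    simpa using hS 0 le_rfl
  | succ m ih =>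
    have hleaf : G.IsLeaf ((Finset.range (m + 1 + 1)).image f) (f 0) (f 1) := by
      refine isLeaf_image (r := fun a b ↦ a + 1 = b ∨ b + 1 = a) ?_ (by simp) (by simp) (by simp)
        (by simp; omega)
      intro a ha b hb
      rw [Finset.mem_range] at ha hb
      exact hadj a (by omega) b (by omega)
    have herase : ((Finset.range (m + 1 + 1)).image f).erase (f 0) =
        (Finset.range (m + 1)).image (fun a ↦ f (a + 1)) := by
      rw [image_erase_of_injOn (B := (Finset.range (m + 1)).image (· + 1)) ?_ (by simp) ?_,
        Finset.image_image]
      · rfl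
      · intro a ha b hb
        simp only [Finset.coe_range, Set.mem_Iio] at ha hb
        exact hf a (by omega) b (by omega)
      · intro b
        simp only [Finset.mem_image, Finset.mem_range]
        refine ⟨by rintro ⟨c, hc, rfl⟩; omega, fun ⟨h1, h2⟩ ↦ ⟨b - 1, by omega, by omega⟩⟩
    have IH (S' : Set I) := ih (fun a ↦ f (a + 1)) (S := S')
      (fun a ha b hb h ↦ by simpa using hf (a + 1) (by omega) (b + 1) (by omega) h)
      (fun a ha b hb ↦ by
        rw [hadj (a + 1) (by omega) (b + 1) (by omega)]
        omega)
    have hconn : G.CutConnected ((Finset.range (m + 1)).image fun a ↦ f (a + 1)) :=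
      (IH {f 1, f (m + 1)} fun a ha ↦ by
        simp only [Set.mem_insert_iff, Set.mem_singleton_iff]
        refine or_congr ⟨fun h ↦ ?_, fun h ↦ by rw [h]⟩ ⟨fun h ↦ ?_, fun h ↦ by rw [h]⟩
        · have := hf _ (by omega) _ (by omega) h
          omega
        · have := hf _ (by omega) _ (by omega) h
          omega).1
    constructor
    · have := hconn.insert (ℓ := f 0) (k := f 1)
        (Finset.mem_image.mpr ⟨0, by simp, by simp⟩) hleaf.adj
      rwa [← herase, Finset.insert_erase hleaf.mem] at this
    · rw [hleaf.ncard_of_mem ((hS 0 (by omega)).mpr (Or.inl rfl)), herase,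
        ncard_connectedPartitions_of_unique hconn (x := f (m + 1))
          (Finset.mem_image.mpr ⟨m, by simp, rfl⟩), (IH (insert (f 1) S) ?_).2]
      · ring
      · intro a ha
        simp only [Set.mem_insert_iff, hS (a + 1) (by omega)]
        refine ⟨fun h ↦ ?_, fun h ↦ ?_⟩
        · rcases h with h | h
          · have := hf _ (by omega) _ (by omega) h
            omega
          · omega
        · rcases h with rfl | rfl <;> simp
      · simp only [Finset.mem_image, Finset.mem_range, forall_exists_index, and_imp,
          forall_apply_eq_imp_iff₂]
        intro a ha
        rw [hS (a + 1) (by omega)]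
        refine ⟨fun h ↦ by rw [show a + 1 = m + 1 by omega], fun h ↦ ?_⟩
        exact Or.inr (hf _ (by omega) _ (by omega) h)

/-- Adjacency in the diagram of type `D n`, whose branch node is `n - 3`. -/
def AdjD (n a b : ℕ) : Prop :=
  (a + 1 = b ∧ b + 2 < n) ∨ (b + 1 = a ∧ a + 2 < n) ∨ (a + 3 = n ∧ (b + 2 = n ∨ b + 1 = n)) ∨
    (b + 3 = n ∧ (a + 2 = n ∨ a + 1 = n))

/-- The partitions of a diagram of type `D n` with `S` the set of its three end nodes. -/
theorem ncard_connectedPartitions_typeD {n : ℕ} (hn : 4 ≤ n) (f : ℕ → I)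
    (hf : ∀ a < n, ∀ b < n, f a = f b → a = b)
    (hadj : ∀ a < n, ∀ b < n, G.Adj (f a) (f b) ↔ AdjD n a b)
    (hS : ∀ a < n, f a ∈ S ↔ a = 0 ∨ a + 2 = n ∨ a + 1 = n) :
    (G.connectedPartitions S ((Finset.range n).image f)).ncard = 3 * (n - 2) + 1 := by
  obtain ⟨m, rfl⟩ : ∃ m, n = m + 4 := ⟨n - 4, by omega⟩
  have hfi : ∀ A : Finset ℕ, A ⊆ Finset.range (m + 4) → Set.InjOn f A := fun A hA a ha b hb ↦
    hf a (by simpa using hA ha) b (by simpa using hA hb)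
  have hadj' : ∀ A : Finset ℕ, A ⊆ Finset.range (m + 4) → ∀ a ∈ A, ∀ b ∈ A,
      G.Adj (f a) (f b) ↔ AdjD (m + 4) a b := fun A hA a ha b hb ↦
    hadj a (by simpa using hA ha) b (by simpa using hA hb)
  have h1 : G.IsLeaf ((Finset.range (m + 4)).image f) (f (m + 3)) (f (m + 1)) :=
    isLeaf_image (hadj' _ subset_rfl) (by simp) (by simp) (by simp [AdjD])
      (by simp [AdjD]; omega)
  have h2 : G.IsLeaf ((Finset.range (m + 3)).image f) (f (m + 2)) (f (m + 1)) :=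
    isLeaf_image (hadj' _ (by simp)) (by simp) (by simp) (by simp [AdjD])
      (by simp [AdjD]; omega)
  have e1 : ((Finset.range (m + 4)).image f).erase (f (m + 3)) = (Finset.range (m + 3)).image f :=
    image_erase_of_injOn (hfi _ subset_rfl) (by simp) (by simp; omega)
  have e2 : ((Finset.range (m + 3)).image f).erase (f (m + 2)) = (Finset.range (m + 2)).image f :=
    image_erase_of_injOn (hfi _ (by simp)) (by simp) (by simp; omega)
  have p1 : (G.connectedPartitions S ((Finset.range (m + 3)).image f)).ncard = m + 3 :=
    (ncard_connectedPartitions_path (m + 2) f (fun a ha b hb ↦ hf a (by omega) b (by omega))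
      (fun a ha b hb ↦ by rw [hadj a (by omega) b (by omega)]; unfold AdjD; omega) rfl
      (fun a ha ↦ by rw [hS a (by omega)]; omega)).2
  have p2 : (G.connectedPartitions (insert (f (m + 1)) S)
      ((Finset.range (m + 2)).image f)).ncard = m + 2 :=
    (ncard_connectedPartitions_path (m + 1) f (fun a ha b hb ↦ hf a (by omega) b (by omega))
      (fun a ha b hb ↦ by rw [hadj a (by omega) b (by omega)]; unfold AdjD; omega) rfl
      (fun a ha ↦ by
        rw [Set.mem_insert_iff, hS a (by omega)]
        refine ⟨?_, ?_⟩
        · rintro (h | h)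
          · exact Or.inr (hf a (by omega) _ (by omega) h)
          · omega
        · rintro (h | h)
          · omega
          · simp [h])).2
  rw [h1.ncard_of_mem ((hS _ (by omega)).mpr (by omega)), e1, p1,
    h2.ncard_of_mem (Set.mem_insert_of_mem _ ((hS _ (by omega)).mpr (by omega))), e2,
    Set.insert_idem, p2]
  omega

/-- Adjacency in the diagram of type `E n`, in Bourbaki's numbering shifted to start from `0`; the
branch node is `3`. -/
def AdjE (a b : ℕ) : Prop :=
  (a = 0 ∧ b = 2) ∨ (b = 0 ∧ a = 2) ∨ (a = 1 ∧ b = 3) ∨ (b = 1 ∧ a = 3) ∨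
    (2 ≤ a ∧ b = a + 1) ∨ (2 ≤ b ∧ a = b + 1)

instance (a b : ℕ) : Decidable (AdjE a b) := by
  unfold AdjE
  infer_instance

/-- The partitions of a diagram of type `E n` with `S` the set of its three end nodes. -/
theorem ncard_connectedPartitions_typeE {n : ℕ} (hn : 6 ≤ n) (f : ℕ → I)
    (hf : ∀ a < n, ∀ b < n, f a = f b → a = b)
    (hadj : ∀ a < n, ∀ b < n, G.Adj (f a) (f b) ↔ AdjE a b)
    (hS : ∀ a < n, f a ∈ S ↔ a = 0 ∨ a = 1 ∨ a + 1 = n) :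
    (G.connectedPartitions S ((Finset.range n).image f)).ncard = 4 * (n - 2) - 2 := by
  obtain ⟨m, rfl⟩ : ∃ m, n = m + 6 := ⟨n - 6, by omega⟩
  have hfi : ∀ A : Finset ℕ, A ⊆ Finset.range (m + 6) → Set.InjOn f A := fun A hA a ha b hb ↦
    hf a (by simpa using hA ha) b (by simpa using hA hb)
  have hadj' : ∀ A : Finset ℕ, A ⊆ Finset.range (m + 6) → ∀ a ∈ A, ∀ b ∈ A,
      G.Adj (f a) (f b) ↔ AdjE a b := fun A hA a ha b hb ↦
    hadj a (by simpa using hA ha) b (by simpa using hA hb)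
  have hmem (T : Set I) : ∀ c < m + 6, ∀ a < m + 6, f a ∈ insert (f c) T ↔ a = c ∨ f a ∈ T :=
    fun c hc a ha ↦ or_congr ⟨hf a ha c hc, fun h ↦ by rw [h]⟩ Iff.rfl
  -- The vertex sets left after removing the nodes `1`, `0` and `2` in turn.
  let A₁ := (Finset.range (m + 6)).erase 1
  let A₂ := A₁.erase 0
  let A₃ := A₂.erase 2
  have hA₁ : ∀ a, a ∈ A₁ ↔ a ≠ 1 ∧ a < m + 6 := by simp [A₁]
  have hA₂ : ∀ a, a ∈ A₂ ↔ 2 ≤ a ∧ a < m + 6 := by simp [A₂, A₁]; omega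
  have hA₃ : ∀ a, a ∈ A₃ ↔ 3 ≤ a ∧ a < m + 6 := by simp [A₃, A₂, A₁]; omega
  have s₁ : A₁ ⊆ Finset.range (m + 6) := fun a ha ↦ by simpa using ((hA₁ a).mp ha).2
  have s₂ : A₂ ⊆ Finset.range (m + 6) := fun a ha ↦ by simpa using ((hA₂ a).mp ha).2
  have h1 : G.IsLeaf ((Finset.range (m + 6)).image f) (f 1) (f 3) :=
    isLeaf_image (hadj' _ subset_rfl) (by simp) (by simp) (by simp [AdjE])
      (by simp [AdjE]; omega)
  have h2 : G.IsLeaf (A₁.image f) (f 0) (f 2) :=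
    isLeaf_image (hadj' _ s₁) ((hA₁ _).mpr (by omega)) ((hA₁ _).mpr (by omega)) (by simp [AdjE])
      (fun b hb ↦ by rw [hA₁] at hb; simp [AdjE])
  have h3 : G.IsLeaf (A₂.image f) (f 2) (f 3) :=
    isLeaf_image (hadj' _ s₂) ((hA₂ _).mpr (by omega)) ((hA₂ _).mpr (by omega)) (by simp [AdjE])
      (fun b hb ↦ by rw [hA₂] at hb; unfold AdjE; omega)
  have e1 : ((Finset.range (m + 6)).image f).erase (f 1) = A₁.image f :=
    image_erase_of_injOn (hfi _ subset_rfl) (by simp) (by simp [A₁])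
  have e2 : (A₁.image f).erase (f 0) = A₂.image f :=
    image_erase_of_injOn (hfi _ s₁) ((hA₁ _).mpr (by omega)) (by simp [A₂])
  have e3 : (A₂.image f).erase (f 2) = A₃.image f :=
    image_erase_of_injOn (hfi _ s₂) ((hA₂ _).mpr (by omega)) (by simp [A₃])
  have p1 : (G.connectedPartitions S (A₁.image f)).ncard = m + 5 := by
    let g : ℕ → ℕ := fun a ↦ if a = 0 then 0 else a + 1
    have hg : ∀ a ≤ m + 4, g a < m + 6 := fun a ha ↦ by grind
    refine (ncard_connectedPartitions_path (m + 4) (fun a ↦ f (g a))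
      (fun a ha b hb h ↦ ?_) (fun a ha b hb ↦ ?_) ?_ (fun a ha ↦ ?_)).2
    · have := hf _ (hg a ha) _ (hg b hb) h
      grind
    · rw [hadj _ (hg a ha) _ (hg b hb)]
      unfold AdjE
      grind
    · trans ((Finset.range (m + 5)).image g).image f
      swap
      · rw [Finset.image_image]; rfl
      congr 1
      ext a
      simp only [hA₁, Finset.mem_image, Finset.mem_range]
      refine ⟨fun ⟨h, h'⟩ ↦ ⟨if a = 0 then 0 else a - 1, by grind⟩, ?_⟩
      rintro ⟨b, hb, rfl⟩
      grind
    · rw [hS _ (hg a ha)]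
      grind
  have p3 (S' : Set I) (hS' : ∀ a, 3 ≤ a → a < m + 6 → (f a ∈ S' ↔ a = 3 ∨ a = m + 5)) :
      (G.connectedPartitions S' (A₃.image f)).ncard = m + 3 := by
    refine (ncard_connectedPartitions_path (m + 2) (fun a ↦ f (a + 3))
      (fun a ha b hb h ↦ by simpa using hf _ (by omega) _ (by omega) h) (fun a ha b hb ↦ ?_) ?_
      (fun a ha ↦ ?_)).2
    · rw [hadj _ (by omega) _ (by omega)]
      unfold AdjE
      omega
    · trans ((Finset.range (m + 3)).image (· + 3)).image f
      swap
      · rw [Finset.image_image]; rfl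
      congr 1
      ext a
      simp only [hA₃, Finset.mem_image, Finset.mem_range]
      exact ⟨fun ⟨h, h'⟩ ↦ ⟨a - 3, by omega, by omega⟩, by rintro ⟨b, hb, rfl⟩; omega⟩
    · rw [hS' _ (by omega) (by omega)]
      omega
  have h2S : f 2 ∉ insert (f 3) S := by
    rw [hmem S 3 (by omega) 2 (by omega), hS 2 (by omega)]
    omega
  rw [h1.ncard_of_mem ((hS _ (by omega)).mpr (by omega)), e1, p1,
    h2.ncard_of_mem (Set.mem_insert_of_mem _ ((hS _ (by omega)).mpr (by omega))), e2,
    h3.ncard_of_notMem h2S, e3, p3 _ fun a ha ha' ↦ ?_, h3.ncard_of_mem (Set.mem_insert _ _), e3,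
    p3 _ fun a ha ha' ↦ ?_, p3 _ fun a ha ha' ↦ ?_]
  · omega
  all_goals
    simp only [hmem _ 2 (by omega) a ha', hmem _ 3 (by omega) a ha', hS a ha']
    omega

end

end SimpleGraph

/-! ### Ranks of sums of squares -/

/-- The columns of the matrix `∑ p, w p • Φ p (Φ p)ᵀ`, with real vectors `Φ p` and nonnegative
weights `w p`, span the same space as the `Φ p` whose weight is nonzero. -/
theorem span_range_sum_weighted_squares {Ω F : Type*} [Fintype F] (Φ : F → Ω → ℂ)
    (hΦ : ∀ p σ, star (Φ p σ) = Φ p σ) (w : F → ℝ) (hw : ∀ p, 0 ≤ w p) :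
    Submodule.span ℂ (Set.range fun τ σ ↦ ∑ p, (w p : ℂ) * (Φ p σ * Φ p τ)) =
      Submodule.span ℂ (Φ '' {p | w p ≠ 0}) := by
  classical
  let r : F → ℂ := fun p ↦ (Real.sqrt (w p) : ℂ)
  have hr : ∀ p, r p * r p = w p := fun p ↦ by
    simp only [r]
    rw [← Complex.ofReal_mul, Real.mul_self_sqrt (hw p)]
  let x : Ω → EuclideanSpace ℂ F := fun τ ↦ WithLp.toLp 2 fun p ↦ r p * Φ p τ
  let Θ : EuclideanSpace ℂ F →ₗ[ℂ] (Ω → ℂ) :=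
    { toFun := fun c σ ↦ ∑ p, c p * (r p * Φ p σ)
      map_add' := fun c d ↦ by
        ext σ
        simp [add_mul, Finset.sum_add_distrib]
      map_smul' := fun a c ↦ by
        ext σ
        simp [Finset.mul_sum, mul_assoc] }
  have hΘx : ∀ τ, Θ (x τ) = fun σ ↦ ∑ p, (w p : ℂ) * (Φ p σ * Φ p τ) := fun τ ↦ by
    ext σ
    simp only [Θ, x, LinearMap.coe_mk, AddHom.coe_mk]
    refine Finset.sum_congr rfl fun p _ ↦ ?_
    rw [← hr p]
    ring
  apply le_antisymm
  · rw [Submodule.span_le]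
    rintro _ ⟨τ, rfl⟩
    have : (fun σ ↦ ∑ p, (w p : ℂ) * (Φ p σ * Φ p τ)) = ∑ p, ((w p : ℂ) * Φ p τ) • Φ p := by
      ext σ
      simp only [Finset.sum_apply, Pi.smul_apply, smul_eq_mul]
      exact Finset.sum_congr rfl fun p _ ↦ by ring
    simp only [this, SetLike.mem_coe]
    refine Submodule.sum_mem _ fun p _ ↦ ?_
    by_cases hp : w p = 0
    · simp [hp]
    · exact Submodule.smul_mem _ _ (Submodule.subset_span ⟨p, hp, rfl⟩)
  · rw [Submodule.span_le]
    rintro _ ⟨p, hp, rfl⟩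
    -- Every vector of the range of `Θ` comes from the span of the `x τ`, whose orthogonal
    -- complement is killed by `Θ`.
    have hker : ∀ c ∈ (Submodule.span ℂ (Set.range x))ᗮ, Θ c = 0 := fun c hc ↦ by
      ext τ
      have := (Submodule.mem_orthogonal _ _).mp hc (x τ) (Submodule.subset_span ⟨τ, rfl⟩)
      rw [PiLp.inner_apply] at this
      simp only [Θ, LinearMap.coe_mk, AddHom.coe_mk, Pi.zero_apply]
      rw [← this]
      refine Finset.sum_congr rfl fun q _ ↦ ?_
      have hs : star (r q * Φ q τ) = r q * Φ q τ := by
        rw [star_mul', hΦ]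
        simp [r]
      simp only [x, RCLike.inner_apply, starRingEnd_apply, hs]
    have hrp : r p ≠ 0 := by
      intro h
      have := hr p
      rw [h, mul_zero, eq_comm, Complex.ofReal_eq_zero] at this
      exact hp this
    let c : EuclideanSpace ℂ F := EuclideanSpace.single p (r p)⁻¹
    have hc : Θ c = Φ p := by
      ext σ
      simp only [Θ, c, LinearMap.coe_mk, AddHom.coe_mk]
      rw [Finset.sum_eq_single p]
      · simp [hrp]
      · intro q _ hq
        simp [hq]
      · simp
    obtain ⟨y, hy, z, hz, hyz⟩ := Submodule.exists_add_mem_mem_orthogonal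
      (K := Submodule.span ℂ (Set.range x)) c
    rw [SetLike.mem_coe, ← hc, hyz, map_add, hker z hz, add_zero]
    have := Submodule.mem_map_of_mem (f := Θ) hy
    rw [Submodule.map_span, ← Set.range_comp] at this
    rwa [show Θ ∘ x = _ from funext hΘx] at this

/-! ### Order of two entries in a list -/

namespace List

variable {I : Type*} {σ : List I} {i j ℓ : I}

theorem pair_sublist_or (hi : i ∈ σ) (hj : j ∈ σ) (hij : i ≠ j) : [i, j] <+ σ ∨ [j, i] <+ σ := by
  induction σ with
  | nil => simp at hi
  | cons a σ ih =>
    rcases List.mem_cons.mp hi with rfl | hi' <;> rcases List.mem_cons.mp hj with rfl | hj'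
    · exact absurd rfl hij
    · exact Or.inl ((List.singleton_sublist.mpr hj').cons_cons _)
    · exact Or.inr ((List.singleton_sublist.mpr hi').cons_cons _)
    · exact (ih hi' hj').imp (·.cons _) (·.cons _)

theorem pair_sublist_cons_of_ne {a : I} (h : i ≠ a) : [i, j] <+ a :: σ ↔ [i, j] <+ σ := by
  refine ⟨fun hs ↦ ?_, fun hs ↦ hs.cons _⟩
  cases hs with
  | cons _ hs => exact hs
  | cons_cons _ hs => exact absurd rfl h

theorem pair_sublist_cons_self (h : i ∉ σ) : [i, j] <+ i :: σ ↔ j ∈ σ := by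
  refine ⟨fun hs ↦ ?_, fun hs ↦ (List.singleton_sublist.mpr hs).cons_cons _⟩
  cases hs with
  | cons _ hs => exact absurd (hs.subset (by simp)) h
  | cons_cons _ hs => exact List.singleton_sublist.mp hs

theorem not_pair_sublist_of_pair_sublist (hσ : σ.Nodup) (h : [i, j] <+ σ) : ¬ [j, i] <+ σ := by
  induction σ with
  | nil => simp at h
  | cons a σ ih =>
    rw [List.nodup_cons] at hσ
    intro h'
    by_cases hi : i = a
    · subst hi
      by_cases hj : j = i
      · subst hj
        exact hσ.1 ((pair_sublist_cons_self hσ.1).mp h)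
      · rw [pair_sublist_cons_of_ne hj] at h'
        exact hσ.1 (h'.subset (by simp))
    · rw [pair_sublist_cons_of_ne hi] at h
      by_cases hj : j = a
      · exact hσ.1 (hj ▸ h.subset (by simp))
      · exact ih hσ.2 h ((pair_sublist_cons_of_ne hj).mp h')

theorem pair_sublist_erase_iff [DecidableEq I] (hi : i ≠ ℓ) (hj : j ≠ ℓ) :
    [i, j] <+ σ.erase ℓ ↔ [i, j] <+ σ := by
  refine ⟨fun h ↦ h.trans (List.erase_sublist), fun h ↦ ?_⟩
  have := h.erase ℓ
  rwa [List.erase_of_not_mem] at this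
  simp [hi.symm, hj.symm]

end List

/-! ### Functions on orderings attached to rooted forests -/

namespace SimpleGraph

open scoped List

variable {I : Type*}

/-- The orderings of a finite set, as lists. -/
abbrev Ordering (J : Finset I) : Type _ := {σ : List I // σ.Nodup ∧ ∀ x, x ∈ σ ↔ x ∈ J}

open Classical in
/-- For `p = some j` the indicator function of the orderings in which `i` comes before `j`, and the
constant function `1` for `p = none`. -/
noncomputable def precedes (i : I) (p : Option I) (σ : List I) : ℂ :=
  p.elim 1 fun j ↦ if [i, j] <+ σ then 1 else 0

/-- A function `p` sends every `i ∈ J` to its parent, or to `none` if `i` is a root; the associated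
function on orderings is the indicator function of the orderings in which parents come after their
children. -/
noncomputable def forestFun (J : Finset I) (p : I → Option I) (σ : Ordering J) : ℂ :=
  ∏ i ∈ J, precedes i (p i) σ.1

/-- Parents are neighbours, and roots lie in `S`. -/
def IsParent (G : SimpleGraph I) (S : Set I) (i : I) : Option I → Prop
  | none => i ∈ S
  | some j => G.Adj i j

/-- The span of the functions on the orderings of `J` attached to the rooted forests in the graph
induced on `J` all of whose roots lie in `S`. Functions `p` with cycles, or with parents outside
`J`, need not be excluded: no ordering has their parents after their children, so that the
associated function is zero. -/
noncomputable def forestSpan (G : SimpleGraph I) (S : Set I) (J : Finset I) :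
    Submodule ℂ (Ordering J → ℂ) :=
  Submodule.span ℂ (forestFun J '' {p | ∀ i ∈ J, G.IsParent S i (p i)})

variable {G : SimpleGraph I} {S : Set I} {J : Finset I} {i j ℓ k : I} {p : I → Option I}

@[simp] theorem precedes_none (i : I) (σ : List I) : precedes i none σ = 1 := rfl

theorem precedes_some_of_sublist {σ : List I} (h : [i, j] <+ σ) : precedes i (some j) σ = 1 :=
  if_pos h

theorem precedes_some_of_not_sublist {σ : List I} (h : ¬ [i, j] <+ σ) :
    precedes i (some j) σ = 0 :=
  if_neg h

theorem star_precedes (i : I) (p : Option I) (σ : List I) :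
    star (precedes i p σ) = precedes i p σ := by
  cases p with
  | none => simp
  | some j =>
    by_cases h : [i, j] <+ σ
    · rw [precedes_some_of_sublist h, star_one]
    · rw [precedes_some_of_not_sublist h, star_zero]

theorem precedes_add_precedes (σ : Ordering J) (hi : i ∈ J) (hj : j ∈ J) (hij : i ≠ j) :
    precedes i (some j) σ.1 + precedes j (some i) σ.1 = 1 := by
  rcases List.pair_sublist_or ((σ.2.2 i).mpr hi) ((σ.2.2 j).mpr hj) hij with h | h
  · rw [precedes_some_of_sublist h, precedes_some_of_not_sublist
      (List.not_pair_sublist_of_pair_sublist σ.2.1 h), add_zero]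
  · rw [precedes_some_of_sublist h, precedes_some_of_not_sublist
      (List.not_pair_sublist_of_pair_sublist σ.2.1 h), zero_add]

theorem precedes_mul_precedes (σ : Ordering J) :
    precedes i (some j) σ.1 * precedes j (some i) σ.1 = 0 := by
  by_cases h : [i, j] <+ σ.1
  · rw [precedes_some_of_not_sublist (List.not_pair_sublist_of_pair_sublist σ.2.1 h), mul_zero]
  · rw [precedes_some_of_not_sublist h, zero_mul]

theorem precedes_eq_zero_of_notMem (σ : Ordering J) (hj : j ∉ J) :
    precedes i (some j) σ.1 = 0 :=
  precedes_some_of_not_sublist fun h ↦ hj ((σ.2.2 j).mp (h.subset (by simp)))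

theorem forestFun_eq_zero (hi : i ∈ J) (hij : p i = some j) (hj : j ∉ J) : forestFun J p = 0 := by
  ext σ
  exact Finset.prod_eq_zero hi (by rw [hij, precedes_eq_zero_of_notMem σ hj])

theorem forestFun_congr {p q : I → Option I} (h : ∀ i ∈ J, p i = q i) :
    forestFun J p = forestFun J q := by
  ext σ
  exact Finset.prod_congr rfl fun i hi ↦ by rw [h i hi]

theorem forestFun_mem (hp : ∀ i ∈ J, G.IsParent S i (p i)) : forestFun J p ∈ G.forestSpan S J :=
  Submodule.subset_span ⟨p, hp, rfl⟩

theorem forestSpan_mono {T : Set I} (h : S ⊆ T) : G.forestSpan S J ≤ G.forestSpan T J := by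
  refine Submodule.span_mono (Set.image_mono fun p hp i hi ↦ ?_)
  have := hp i hi
  match h' : p i with
  | none => rw [h'] at this; exact h this
  | some j => rwa [h'] at this

theorem finrank_forestSpan_empty : finrank ℂ (G.forestSpan S ∅) = 1 := by
  let σ : Ordering (∅ : Finset I) := ⟨[], by simp⟩
  have h : forestFun (∅ : Finset I) '' {p | ∀ i ∈ (∅ : Finset I), G.IsParent S i (p i)} = {1} :=
    Set.eq_singleton_iff_unique_mem.mpr ⟨⟨fun _ ↦ none, by simp, rfl⟩, by rintro _ ⟨p, -, rfl⟩; rfl⟩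
  rw [forestSpan, h]
  exact finrank_span_singleton fun h ↦ one_ne_zero (congrFun h σ)

theorem forestSpan_singleton (hi : i ∈ S) : G.forestSpan S {i} = Submodule.span ℂ {1} := by
  have h1 : forestFun {i} (fun _ ↦ none) = 1 := by
    ext σ
    simp [forestFun]
  apply le_antisymm
  · rw [forestSpan, Submodule.span_le]
    rintro _ ⟨p, hp, rfl⟩
    match hpi : p i with
    | none =>
      rw [forestFun_congr (q := fun _ ↦ none) (by simpa using hpi), h1]
      exact Submodule.mem_span_singleton_self 1
    | some j =>
      have := hp i (by simp)
      rw [hpi] at this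
      rw [forestFun_eq_zero (by simp) hpi (by simpa using Adj.ne' this)]
      exact Submodule.zero_mem _
  · rw [Submodule.span_singleton_le_iff_mem, ← h1]
    exact forestFun_mem fun j hj ↦ by
      rw [Finset.mem_singleton.mp hj]
      exact hi

theorem forestSpan_singleton_eq_bot (hi : i ∉ S) : G.forestSpan S {i} = ⊥ := by
  rw [eq_bot_iff, forestSpan, Submodule.span_le]
  rintro _ ⟨p, hp, rfl⟩
  have := hp i (by simp)
  match hpi : p i with
  | none =>
    rw [hpi] at this
    exact absurd this hi
  | some j =>
    rw [hpi] at this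
    exact forestFun_eq_zero (by simp) hpi (by simpa using Adj.ne' this)

variable [DecidableEq I]

instance [Finite I] : FiniteDimensional ℂ (G.forestSpan S J) :=
  FiniteDimensional.span_of_finite ℂ (Set.toFinite _)

/-- Dropping an element from an ordering. -/
def Ordering.erase (ℓ : I) (σ : Ordering J) : Ordering (J.erase ℓ) :=
  ⟨σ.1.erase ℓ, σ.2.1.erase ℓ, fun x ↦ by
    rw [σ.2.1.mem_erase_iff, Finset.mem_erase, σ.2.2]⟩

theorem precedes_erase (σ : Ordering J) (hi : i ≠ ℓ) {q : Option I} (hq : q ≠ some ℓ) :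
    precedes i q (σ.erase ℓ).1 = precedes i q σ.1 := by
  cases q with
  | none => rfl
  | some j =>
    have hj : j ≠ ℓ := fun h ↦ hq (h ▸ rfl)
    by_cases h : [i, j] <+ σ.1
    · rw [precedes_some_of_sublist h]
      exact precedes_some_of_sublist ((List.pair_sublist_erase_iff hi hj).mpr h)
    · rw [precedes_some_of_not_sublist h]
      exact precedes_some_of_not_sublist (mt (List.pair_sublist_erase_iff hi hj).mp h)

/-- Two functions on the orderings of `J \ {ℓ}` are glued to one on the orderings of `J`, according
to the relative position of `ℓ` and `k`. -/
noncomputable def glue (J : Finset I) (ℓ k : I) :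
    ((Ordering (J.erase ℓ) → ℂ) × (Ordering (J.erase ℓ) → ℂ)) →ₗ[ℂ] (Ordering J → ℂ) where
  toFun g σ := precedes ℓ (some k) σ.1 * g.1 (σ.erase ℓ) +
    precedes k (some ℓ) σ.1 * g.2 (σ.erase ℓ)
  map_add' g h := by
    ext σ
    simp only [Prod.fst_add, Prod.snd_add, Pi.add_apply]
    ring
  map_smul' c g := by
    ext σ
    simp only [Prod.smul_fst, Prod.smul_snd, Pi.smul_apply, smul_eq_mul, RingHom.id_apply]
    ring

theorem glue_apply (g h : Ordering (J.erase ℓ) → ℂ) (σ : Ordering J) :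
    glue J ℓ k (g, h) σ = precedes ℓ (some k) σ.1 * g (σ.erase ℓ) +
      precedes k (some ℓ) σ.1 * h (σ.erase ℓ) := rfl

theorem glue_injective (hℓ : ℓ ∈ J) (hk : k ∈ J.erase ℓ) : Function.Injective (glue J ℓ k) := by
  rw [← LinearMap.ker_eq_bot, LinearMap.ker_eq_bot']
  rintro ⟨g, h⟩ hgh
  have hnot : ∀ τ : Ordering (J.erase ℓ), ℓ ∉ τ.1 := fun τ hmem ↦ by
    simpa using (τ.2.2 ℓ).mp hmem
  have hkmem : ∀ τ : Ordering (J.erase ℓ), k ∈ τ.1 := fun τ ↦ (τ.2.2 k).mpr hk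
  have hmem : ∀ (τ : Ordering (J.erase ℓ)) x, x = ℓ ∨ x ∈ τ.1 ↔ x ∈ J := fun τ x ↦ by
    rw [τ.2.2, Finset.mem_erase]
    by_cases hx : x = ℓ <;> simp [hx, hℓ]
  refine Prod.ext ?_ ?_ <;> ext τ
  · -- Put `ℓ` in front.
    let σ : Ordering J := ⟨ℓ :: τ.1, List.nodup_cons.mpr ⟨hnot τ, τ.2.1⟩, fun x ↦ by
      rw [List.mem_cons, hmem]⟩
    have hs : [ℓ, k] <+ σ.1 := (List.pair_sublist_cons_self (hnot τ)).mpr (hkmem τ)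
    have he : σ.erase ℓ = τ := Subtype.ext (by simp [σ, Ordering.erase])
    have := congrFun hgh σ
    rwa [glue_apply, precedes_some_of_sublist hs, precedes_some_of_not_sublist
      (List.not_pair_sublist_of_pair_sublist σ.2.1 hs), he, one_mul, zero_mul, add_zero] at this
  · -- Put `ℓ` at the end.
    let σ : Ordering J := ⟨τ.1 ++ [ℓ], by
      rw [List.nodup_append]
      exact ⟨τ.2.1, by simp, fun a ha b hb ↦ by
        rw [List.mem_singleton.mp hb]
        rintro rfl
        exact hnot τ ha⟩, fun x ↦ by
      rw [List.mem_append, List.mem_singleton, or_comm, hmem]⟩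
    have hs : [k, ℓ] <+ σ.1 := (List.singleton_sublist.mpr (hkmem τ)).append_right [ℓ]
    have he : σ.erase ℓ = τ := Subtype.ext (by
      simp [σ, Ordering.erase, List.erase_append_right _ (hnot τ)])
    have := congrFun hgh σ
    rwa [glue_apply, precedes_some_of_sublist hs, precedes_some_of_not_sublist
      (List.not_pair_sublist_of_pair_sublist σ.2.1 hs), he, one_mul, zero_mul, zero_add] at this

namespace IsLeaf

/-- Splitting off the factor of a leaf `ℓ` which is not the parent of its neighbour `k`. -/
theorem forestFun_eq (h : G.IsLeaf J ℓ k) (hp : ∀ i ∈ J, G.IsParent S i (p i))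
    (hk : p k ≠ some ℓ) (σ : Ordering J) :
    forestFun J p σ = precedes ℓ (p ℓ) σ.1 * forestFun (J.erase ℓ) p (σ.erase ℓ) := by
  rw [forestFun, ← Finset.mul_prod_erase J _ h.mem]
  congr 1
  refine Finset.prod_congr rfl fun i hi ↦ (precedes_erase σ (Finset.ne_of_mem_erase hi) ?_).symm
  intro hiℓ
  have := hp i (Finset.mem_of_mem_erase hi)
  rw [hiℓ] at this
  exact hk (h.unique i (Finset.mem_of_mem_erase hi) this.symm ▸ hiℓ)

/-- Splitting off the factors of a leaf `ℓ` and of its neighbour `k`, when `ℓ` is the parent of `k`: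
what remains is a forest on `J \ {ℓ}` with root `k`. -/
theorem forestFun_eq_of_parent (h : G.IsLeaf J ℓ k) (hp : ∀ i ∈ J, G.IsParent S i (p i))
    (hk : p k = some ℓ) (σ : Ordering J) :
    forestFun J p σ = precedes ℓ (p ℓ) σ.1 * precedes k (some ℓ) σ.1 *
      forestFun (J.erase ℓ) (Function.update p k none) (σ.erase ℓ) := by
  rw [forestFun, ← Finset.mul_prod_erase J _ h.mem, mul_assoc, forestFun,
    ← Finset.mul_prod_erase _ _ h.nbr_mem_erase, ← Finset.mul_prod_erase _ _ h.nbr_mem_erase, hk,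
    Function.update_self, precedes_none, one_mul]
  congr 2
  refine Finset.prod_congr rfl fun i hi ↦ ?_
  rw [Finset.mem_erase, Finset.mem_erase] at hi
  rw [Function.update_of_ne hi.1]
  refine (precedes_erase σ hi.2.1 ?_).symm
  intro hiℓ
  have := hp i hi.2.2
  rw [hiℓ] at this
  exact hi.1 (h.unique i hi.2.2 this.symm)

/-- How the forest functions on `J` arise from those on `J \ {ℓ}`: an ordering in which the leaf
`ℓ` comes before its neighbour `k` sees the forests with roots in `S`; one in which `ℓ` comes
after `k` sees, if `ℓ ∈ S`, also the forests in which `k` is the child of the root `ℓ`. -/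
theorem forestSpan_eq [DecidablePred (· ∈ S)] (h : G.IsLeaf J ℓ k) :
    G.forestSpan S J = ((G.forestSpan S (J.erase ℓ)).prod
      (if ℓ ∈ S then G.forestSpan (insert k S) (J.erase ℓ) else ⊥)).map (glue J ℓ k) := by
  have hsub : ∀ {T : Set I} {q : I → Option I}, (∀ i ∈ J.erase ℓ, G.IsParent T i (q i)) →
      ∀ o, G.IsParent T ℓ o → ∀ i ∈ J, G.IsParent T i (Function.update q ℓ o i) := by
    intro T q hq o ho i hi
    by_cases hiℓ : i = ℓ
    · subst hiℓ
      rwa [Function.update_self]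
    · rw [Function.update_of_ne hiℓ]
      exact hq i (Finset.mem_erase.mpr ⟨hiℓ, hi⟩)
  have hupd : ∀ (q : I → Option I) o, forestFun (J.erase ℓ) (Function.update q ℓ o) =
      forestFun (J.erase ℓ) q := fun q o ↦
    forestFun_congr fun i hi ↦ Function.update_of_ne (Finset.ne_of_mem_erase hi) _ _
  have hkℓ := h.ne.symm
  -- The functions `[ℓ before k] * g` lie in the span for every `g` in the span for `J \ {ℓ}`.
  have hleft : ∀ q : I → Option I, (∀ i ∈ J.erase ℓ, G.IsParent S i (q i)) →
      glue J ℓ k (forestFun (J.erase ℓ) q, 0) ∈ G.forestSpan S J := by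
    intro q hq
    by_cases hqk : q k = some ℓ
    · rw [forestFun_eq_zero h.nbr_mem_erase hqk (by simp)]
      exact (map_zero (glue J ℓ k)).symm ▸ Submodule.zero_mem _
    · have hp := hsub hq (some k) h.adj
      convert forestFun_mem hp using 1
      ext σ
      rw [h.forestFun_eq hp (by rwa [Function.update_of_ne hkℓ]), Function.update_self, hupd,
        glue_apply, Pi.zero_apply, mul_zero, add_zero]
  have hright : ℓ ∈ S → ∀ q : I → Option I,
      (∀ i ∈ J.erase ℓ, G.IsParent (insert k S) i (q i)) →
      glue J ℓ k (0, forestFun (J.erase ℓ) q) ∈ G.forestSpan S J := by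
    intro hℓS q hq
    match hqk : q k with
    | none =>
      -- Here `k` becomes a child of the root `ℓ`.
      have hq' : ∀ i ∈ J.erase ℓ, G.IsParent S i (Function.update q k (some ℓ) i) := by
        intro i hi
        by_cases hik : i = k
        · subst hik
          rw [Function.update_self]
          exact h.adj.symm
        · rw [Function.update_of_ne hik]
          have := hq i hi
          match hqi : q i with
          | none =>
            rw [hqi] at this
            exact Set.mem_of_mem_insert_of_ne this hik
          | some j => rwa [hqi] at this
      have hp := hsub hq' none hℓS
      convert forestFun_mem hp using 1
      ext σ
      have e : forestFun (J.erase ℓ) (Function.update (Function.update (Function.update q k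
          (some ℓ)) ℓ none) k none) = forestFun (J.erase ℓ) q := by
        refine forestFun_congr fun i hi ↦ ?_
        by_cases hik : i = k
        · subst hik
          rw [Function.update_self, hqk]
        · rw [Function.update_of_ne hik, Function.update_of_ne (Finset.ne_of_mem_erase hi),
            Function.update_of_ne hik]
      rw [h.forestFun_eq_of_parent hp (by rw [Function.update_of_ne hkℓ, Function.update_self]),
        Function.update_self, e, precedes_none, one_mul, glue_apply, Pi.zero_apply, mul_zero,
        zero_add]
    | some j =>
      by_cases hjℓ : j = ℓ
      · rw [forestFun_eq_zero h.nbr_mem_erase hqk (by simp [hjℓ])]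
        exact (map_zero (glue J ℓ k)).symm ▸ Submodule.zero_mem _
      -- Here `k` is not a root, and `[ℓ after k] = 1 - [ℓ before k]` applies.
      have hq' : ∀ i ∈ J.erase ℓ, G.IsParent S i (q i) := by
        intro i hi
        have := hq i hi
        match hqi : q i with
        | none =>
          rw [hqi] at this
          refine Set.mem_of_mem_insert_of_ne this ?_
          rintro rfl
          simp [hqi] at hqk
        | some j => rwa [hqi] at this
      have hp := hsub hq' none hℓS
      have : glue J ℓ k (0, forestFun (J.erase ℓ) q) =
          forestFun J (Function.update q ℓ none) - glue J ℓ k (forestFun (J.erase ℓ) q, 0) := by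
        ext σ
        have hadd := precedes_add_precedes σ h.mem h.nbr_mem h.ne
        rw [Pi.sub_apply, h.forestFun_eq hp (by
          rw [Function.update_of_ne hkℓ, hqk]
          simpa using hjℓ), Function.update_self, hupd, glue_apply, glue_apply, Pi.zero_apply,
          precedes_none]
        linear_combination (forestFun (J.erase ℓ) q (σ.erase ℓ)) * hadd
      rw [this]
      exact Submodule.sub_mem _ (forestFun_mem hp) (hleft q hq')
  apply le_antisymm
  · rw [forestSpan, Submodule.span_le]
    rintro _ ⟨p, hp, rfl⟩
    have hp' : ∀ i ∈ J.erase ℓ, G.IsParent S i (p i) := fun i hi ↦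
      hp i (Finset.mem_of_mem_erase hi)
    have hℓ := hp ℓ h.mem
    rw [SetLike.mem_coe, Submodule.mem_map]
    match hpℓ : p ℓ with
    | some j =>
      rw [hpℓ] at hℓ
      by_cases hj : j ∈ J
      swap
      · exact ⟨0, Submodule.zero_mem _, by rw [forestFun_eq_zero h.mem hpℓ hj, map_zero]⟩
      obtain rfl := h.unique j hj hℓ
      by_cases hk : p j = some ℓ
      · refine ⟨0, Submodule.zero_mem _, ?_⟩
        ext σ
        rw [h.forestFun_eq_of_parent hp hk, hpℓ, precedes_mul_precedes, zero_mul, map_zero,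
          Pi.zero_apply]
      · refine ⟨(forestFun (J.erase ℓ) p, 0), ⟨forestFun_mem hp', Submodule.zero_mem _⟩, ?_⟩
        ext σ
        rw [h.forestFun_eq hp hk, hpℓ, glue_apply, Pi.zero_apply, mul_zero, add_zero]
    | none =>
      rw [hpℓ] at hℓ
      have hℓS : ℓ ∈ S := hℓ
      by_cases hk : p k = some ℓ
      · refine ⟨(0, forestFun (J.erase ℓ) (Function.update p k none)),
          ⟨Submodule.zero_mem _, ?_⟩, ?_⟩
        · rw [if_pos hℓS]
          refine forestFun_mem fun i hi ↦ ?_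
          by_cases hik : i = k
          · subst hik
            rw [Function.update_self]
            exact Set.mem_insert _ _
          · rw [Function.update_of_ne hik]
            have := hp' i hi
            match hpi : p i with
            | none =>
              rw [hpi] at this
              exact Set.mem_insert_of_mem _ this
            | some j => rwa [hpi] at this
        · ext σ
          rw [h.forestFun_eq_of_parent hp hk, hpℓ, precedes_none, one_mul, glue_apply,
            Pi.zero_apply, mul_zero, zero_add]
      · refine ⟨(forestFun (J.erase ℓ) p, forestFun (J.erase ℓ) p), ⟨forestFun_mem hp', ?_⟩, ?_⟩
        · rw [if_pos hℓS]
          exact forestSpan_mono (Set.subset_insert _ _) (forestFun_mem hp')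
        · ext σ
          rw [h.forestFun_eq hp hk, hpℓ, precedes_none, one_mul, glue_apply, ← add_mul,
            precedes_add_precedes σ h.mem h.nbr_mem h.ne, one_mul]
  · rw [Submodule.map_le_iff_le_comap]
    rintro ⟨g₁, g₂⟩ ⟨hg₁, hg₂⟩
    have hsplit : ((g₁, g₂) : (Ordering (J.erase ℓ) → ℂ) × (Ordering (J.erase ℓ) → ℂ)) =
        LinearMap.inl ℂ _ _ g₁ + LinearMap.inr ℂ _ _ g₂ := by simp
    rw [Submodule.mem_comap, hsplit, map_add]
    refine Submodule.add_mem _ ?_ ?_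
    · have : G.forestSpan S (J.erase ℓ) ≤
          (G.forestSpan S J).comap (glue J ℓ k ∘ₗ LinearMap.inl ℂ _ _) := by
        rw [forestSpan, Submodule.span_le]
        rintro _ ⟨q, hq, rfl⟩
        exact hleft q hq
      exact this hg₁
    · by_cases hℓS : ℓ ∈ S
      · rw [if_pos hℓS] at hg₂
        have : G.forestSpan (insert k S) (J.erase ℓ) ≤
            (G.forestSpan S J).comap (glue J ℓ k ∘ₗ LinearMap.inr ℂ _ _) := by
          rw [forestSpan, Submodule.span_le]
          rintro _ ⟨q, hq, rfl⟩
          exact hright hℓS q hq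
        exact this hg₂
      · rw [if_neg hℓS] at hg₂
        rw [show g₂ = 0 from hg₂, map_zero, map_zero]
        exact Submodule.zero_mem _

end IsLeaf

/-- The forest functions on a connected set `J` span a space whose dimension is the number of
partitions into connected blocks meeting `S`. -/
theorem finrank_forestSpan [Finite I] (hG : G.HasLeaves) (hJ : G.CutConnected J) :
    finrank ℂ (G.forestSpan S J) = (G.connectedPartitions S J).ncard := by
  classical
  refine hJ.leaf_induction hG (P := fun J ↦ ∀ S : Set I,
    finrank ℂ (G.forestSpan S J) = (G.connectedPartitions S J).ncard) ?_ ?_ ?_ S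
  · intro S
    rw [finrank_forestSpan_empty, ncard_connectedPartitions_empty]
  · intro i S
    by_cases hi : i ∈ S
    · rw [forestSpan_singleton hi, ncard_connectedPartitions_of_unique (x := i)
        cutConnected_singleton (by simp) (by simpa using hi)]
      let σ : Ordering ({i} : Finset I) := ⟨[i], by simp⟩
      exact finrank_span_singleton fun h ↦ one_ne_zero (congrFun h σ)
    · rw [forestSpan_singleton_eq_bot hi, finrank_bot,
        ncard_connectedPartitions_of_disjoint (by simp) (by simpa using hi)]
  · intro J ℓ k hJ h IH S
    rw [h.forestSpan_eq, ← (Submodule.equivMapOfInjective _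
      (glue_injective h.mem h.nbr_mem_erase) _).finrank_eq]
    have hprod : ∀ A B : Submodule ℂ (Ordering (J.erase ℓ) → ℂ), ∀ [FiniteDimensional ℂ A]
        [FiniteDimensional ℂ B], finrank ℂ (A.prod B) = finrank ℂ A + finrank ℂ B := by
      intro A B _ _
      rw [← finrank_prod]
      exact LinearEquiv.finrank_eq
        { toFun := fun x ↦ (⟨x.1.1, x.2.1⟩, ⟨x.1.2, x.2.2⟩)
          invFun := fun y ↦ ⟨(y.1, y.2), y.1.2, y.2.2⟩
          map_add' := fun _ _ ↦ rfl
          map_smul' := fun _ _ ↦ rfl }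
    by_cases hℓ : ℓ ∈ S
    · rw [if_pos hℓ, hprod, IH, IH, h.ncard_of_mem hℓ]
    · rw [if_neg hℓ, hprod, IH, finrank_bot, add_zero, h.ncard_of_notMem hℓ]

end SimpleGraph

/-! ### Supports of positive roots -/

namespace RootPairing.Base

variable {ι R M N : Type*} [Field R] [CharZero R] [AddCommGroup M] [Module R M]
  [AddCommGroup N] [Module R N] {P : RootPairing ι R M N} (b : P.Base)

theorem repr_sum_nsmul [P.IsRootSystem] (c : b.support → ℕ) (j : b.support) :
    b.toWeightBasis.repr (∑ i, c i • P.root i) j = c j := by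
  classical
  rw [map_sum, Finsupp.finsetSum_apply, Finset.sum_eq_single j]
  · simp
  · intro i _ hij
    simp [hij]
  · simp

open Classical in
theorem theta_eq_sum (K : Finset b.support) :
    b.theta K = ∑ i, (if i ∈ K then 1 else 0 : ℕ) • P.root i := by
  simp [theta, ite_smul, Finset.sum_ite_mem, -Finset.univ_eq_attach]

open Classical in
theorem repr_theta [P.IsRootSystem] (K : Finset b.support) (j : b.support) :
    b.toWeightBasis.repr (b.theta K) j = if j ∈ K then 1 else 0 := by
  rw [theta_eq_sum, repr_sum_nsmul]
  split_ifs <;> simp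

theorem mem_rootSupport_theta [P.IsRootSystem] {K : Finset b.support} {j : b.support} :
    j ∈ b.rootSupport (b.theta K) ↔ j ∈ K := by
  simp [rootSupport, repr_theta]

theorem theta_injective [P.IsRootSystem] : Function.Injective b.theta := fun K L h ↦ by
  ext j
  rw [← mem_rootSupport_theta, h, mem_rootSupport_theta]

theorem repr_list_sum [P.IsRootSystem] [BEq b.support] [LawfulBEq b.support] (w : List b.support)
    (j : b.support) :
    b.toWeightBasis.repr (w.map fun i : b.support ↦ P.root i).sum j = w.count j := by
  classical
  induction w with
  | nil => simp
  | cons i w ih =>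
    rw [List.map_cons, List.sum_cons, map_add, Finsupp.add_apply, ih,
      toWeightBasis_repr_root, List.count_cons, Finsupp.single_apply]
    by_cases hij : i = j <;> simp [hij, add_comm]

variable {b} in
/-- A sum of simple roots is `ϑ_J` if and only if its terms are an ordering of `J`. -/
theorem list_sum_eq_theta_iff [P.IsRootSystem] {J : Finset b.support} {w : List b.support} :
    (w.map fun i : b.support ↦ P.root i).sum = b.theta J ↔ w.Nodup ∧ ∀ x, x ∈ w ↔ x ∈ J := by
  classical
  constructor
  · intro h
    have hJ : ∀ j, w.count j = if j ∈ J then 1 else 0 := fun j ↦ by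
      have h1 := b.repr_list_sum w j
      rw [h, repr_theta] at h1
      split_ifs at h1 ⊢ <;> exact_mod_cast h1.symm
    refine ⟨List.nodup_iff_count_le_one.mpr fun j ↦ ?_, fun j ↦ ?_⟩
    · rw [hJ]
      split_ifs <;> simp
    · rw [← List.count_pos_iff, hJ]
      split_ifs with hj <;> simp [hj]
  · rintro ⟨hw, hmem⟩
    obtain rfl : w.toFinset = J := by
      ext x
      rw [List.mem_toFinset, hmem]
    exact (List.sum_toFinset _ hw).symm

variable [Finite ι]

theorem adj_iff_pairing {i j : b.support} :
    b.dynkinGraph.Adj i j ↔ i ≠ j ∧ P.pairing i j ≠ 0 := Iff.rfl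

theorem pairing_eq_zero_of_not_adj {i j : b.support} (h : i ≠ j) (ha : ¬ b.dynkinGraph.Adj i j) :
    P.pairing i j = 0 := by
  by_contra h0
  exact ha ⟨h, h0⟩

variable [P.IsCrystallographic]

/-- The Dynkin diagram is a forest: otherwise all nodes of some nonempty set `K` have two
neighbours in `K`, and then the sum of the simple roots in `K`, suitably normalised, has
nonpositive norm. -/
theorem hasLeaves_dynkinGraph [P.IsRootSystem] : b.dynkinGraph.HasLeaves := by
  classical
  obtain ⟨d, hd, hpos⟩ := b.exists_cartanMatrix_mul_diagaonal_posDef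
  intro K hK
  by_contra! hcon
  set A := b.cartanMatrix * Matrix.diagonal d with hA
  have hAapp : ∀ i j, A i j = b.cartanMatrix i j * d j := fun i j ↦ by
    rw [hA, Matrix.mul_diagonal]
  have hsymm : ∀ i j, A i j = A j i := fun i j ↦ by
    have := hpos.isHermitian.apply i j
    simpa using this.symm
  have hnonpos : ∀ i j, i ≠ j → A i j ≤ 0 := fun i j hij ↦ by
    rw [hAapp]
    exact mul_nonpos_of_nonpos_of_nonneg (b.cartanMatrix_le_zero_of_ne i j hij) (hd j).le
  have hadj : ∀ i j, b.dynkinGraph.Adj i j → A i j ≤ - d i := fun i j h ↦ by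
    rw [hsymm, hAapp]
    have h0 : b.cartanMatrix j i ≠ 0 := fun h0 ↦
      h.symm.2 (b.cartanMatrix_apply_eq_zero_iff_pairing.mp h0)
    have := b.cartanMatrix_le_zero_of_ne j i h.symm.1
    have : b.cartanMatrix j i ≤ -1 := by omega
    nlinarith [hd i]
  let x : b.support → ℤ := fun i ↦ if i ∈ K then 1 else 0
  have hx : x ≠ 0 := fun h ↦ by
    obtain ⟨i, hi⟩ := hK
    simpa [x, hi] using congrFun h i
  have hlt := hpos.dotProduct_mulVec_pos hx
  have hval : star x ⬝ᵥ A.mulVec x = ∑ i ∈ K, ∑ j ∈ K, A i j := by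
    simp [dotProduct, Matrix.mulVec, x, Finset.sum_ite_mem, -Finset.univ_eq_attach]
  rw [hval] at hlt
  refine absurd hlt (not_lt.mpr (Finset.sum_nonpos fun i hi ↦ ?_))
  obtain ⟨j, hj, j', hj', hij, hij', hne⟩ := hcon i hi
  have hsub : ({i, j, j'} : Finset b.support) ⊆ K := by
    simp [Finset.insert_subset_iff, hi, hj, hj']
  rw [← Finset.sum_sdiff hsub, Finset.sum_insert (by simp [hij.1, hij'.1]),
    Finset.sum_insert (by simpa using hne), Finset.sum_singleton]
  have h1 : ∑ j ∈ K \ {i, j, j'}, A i j ≤ 0 := Finset.sum_nonpos fun m hm ↦ hnonpos i m (by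
    rintro rfl
    simp at hm)
  have h2 : A i i = 2 * d i := by rw [hAapp, b.cartanMatrix_apply_same]
  linarith [hadj i j hij, hadj i j' hij']

variable {b} [P.IsRootSystem]

/-- A positive root is a natural combination of the simple roots, with connected support. -/
theorem IsPos.exists_eq_sum_nsmul {α : ι} (hα : b.IsPos α) :
    ∃ c : b.support → ℕ, P.root α = ∑ j, c j • P.root j ∧
      b.dynkinGraph.CutConnected (Finset.univ.filter fun j ↦ c j ≠ 0) := by
  classical
  refine hα.induction_on_add (p := fun α ↦ ∃ c : b.support → ℕ, P.root α = ∑ j, c j • P.root j ∧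
    b.dynkinGraph.CutConnected (Finset.univ.filter fun j ↦ c j ≠ 0)) ?_ ?_
  · intro i hi
    refine ⟨Pi.single ⟨i, hi⟩ 1, ?_, ?_⟩
    · simp [Pi.single_apply, ite_smul]
    · have : (Finset.univ.filter fun j ↦ (Pi.single ⟨i, hi⟩ 1 : b.support → ℕ) j ≠ 0) =
          {⟨i, hi⟩} := by
        ext j
        simp [Pi.single_apply]
      rw [this]
      exact SimpleGraph.cutConnected_singleton
  · rintro α j γ hγ ⟨c, hc, hconn⟩ hj
    let j' : b.support := ⟨j, hj⟩
    refine ⟨c + Pi.single j' 1, ?_, ?_⟩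
    · rw [hγ, hc]
      simp [add_smul, Finset.sum_add_distrib, Pi.single_apply, ite_smul, j']
    · have hsupp : (Finset.univ.filter fun m ↦ (c + Pi.single j' 1 : b.support → ℕ) m ≠ 0) =
          insert j' (Finset.univ.filter fun m ↦ c m ≠ 0) := by
        ext m
        by_cases hm : m = j' <;> simp [hm, Pi.single_apply]
      rw [hsupp]
      by_cases hcj : c j' = 0
      swap
      · rwa [Finset.insert_eq_self.mpr (by simpa using hcj)]
      by_cases hadj : ∃ m ∈ Finset.univ.filter fun m ↦ c m ≠ 0, b.dynkinGraph.Adj j' m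
      · obtain ⟨m, hm, ha⟩ := hadj
        exact hconn.insert hm ha
      -- Otherwise `α` is orthogonal to `j`, and reflecting `α + j` gives the root `α - j`, whose
      -- coefficients have different signs.
      exfalso
      push Not at hadj
      have horth : P.pairing α j = 0 := by
        rw [← P.root_coroot_eq_pairing, hc, map_sum, LinearMap.sum_apply]
        refine Finset.sum_eq_zero fun m _ ↦ ?_
        by_cases hm : c m = 0
        · simp [hm]
        · have hne : m ≠ j' := fun h ↦ hm (h ▸ hcj)
          have := pairing_eq_zero_of_not_adj b hne fun h ↦ hadj m (by simpa using hm) h.symm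
          rw [map_nsmul, LinearMap.smul_apply, P.root_coroot_eq_pairing]
          exact (congrArg _ this).trans (smul_zero _)
      have hroot : P.root (P.reflectionPerm j γ) = P.root α - P.root j := by
        rw [root_reflectionPerm, reflection_apply_root, ← P.root_coroot_eq_pairing, hγ, map_add,
          LinearMap.add_apply, P.root_coroot_eq_pairing, horth, P.root_coroot_eq_pairing,
          P.pairing_same]
        module
      have hrepr : ∀ m, b.toWeightBasis.repr (P.root (P.reflectionPerm j γ)) m =
          c m - if m = j' then 1 else 0 := fun m ↦ by
        rw [hroot, hc, map_sub, Finsupp.sub_apply, repr_sum_nsmul,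
          b.toWeightBasis_repr_root j', Finsupp.single_apply]
        simp [eq_comm]
      obtain ⟨m, hm⟩ : ∃ m, c m ≠ 0 := by
        by_contra! h
        exact P.ne_zero α (by simp [hc, h])
      have hmj : m ≠ j' := fun h ↦ hm (h ▸ hcj)
      obtain ⟨f, -, hf | hf⟩ := b.exists_root_eq_sum_nat_or_neg (P.reflectionPerm j γ)
      all_goals rw [← Finset.sum_coe_sort] at hf
      · have := hrepr j'
        rw [hf, repr_sum_nsmul b (fun i ↦ f i), hcj, if_pos rfl, Nat.cast_zero, zero_sub,
          eq_neg_iff_add_eq_zero] at this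
        exact Nat.cast_add_one_ne_zero _ this
      · have := hrepr m
        rw [hf, map_neg, Finsupp.neg_apply, repr_sum_nsmul b (fun i ↦ f i), if_neg hmj, sub_zero,
          neg_eq_iff_add_eq_zero] at this
        norm_cast at this
        omega

/-- The sum of the simple roots in a nonempty connected set is a positive root. -/
theorem exists_root_eq_theta {K : Finset b.support} (hK : b.dynkinGraph.CutConnected K)
    (hne : K.Nonempty) : ∃ α, b.IsPos α ∧ P.root α = b.theta K := by
  classical
  suffices ∃ α, P.root α = b.theta K by
    obtain ⟨α, hα⟩ := this
    refine ⟨α, ?_, hα⟩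
    have : P.root α = ∑ j ∈ b.support, (if h : j ∈ b.support then
        if (⟨j, h⟩ : b.support) ∈ K then 1 else 0 else 0 : ℤ) • P.root j := by
      rw [hα, theta_eq_sum, ← Finset.sum_coe_sort b.support]
      refine Finset.sum_congr rfl fun j _ ↦ ?_
      simp
    rw [isPos_iff', height_eq_sum this]
    refine Finset.sum_nonneg fun j _ ↦ ?_
    split_ifs <;> simp
  refine hK.leaf_induction b.hasLeaves_dynkinGraph (P := fun K ↦ K.Nonempty →
    ∃ α, P.root α = b.theta K) (by simp) ?_ ?_ hne
  · intro i _
    exact ⟨i, by simp [theta]⟩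
  · intro J ℓ k hJ h ih _
    obtain ⟨α, hα⟩ := ih ⟨k, h.nbr_mem_erase⟩
    have hsum : P.root α + P.root ℓ = b.theta J := by
      rw [hα, theta, theta, Finset.sum_erase_add _ _ h.mem]
    rw [← hsum]
    refine P.root_add_root_mem_of_pairingIn_neg ?_ fun hneg ↦ ?_
    · have hpair : P.pairingIn ℤ α ℓ = P.pairingIn ℤ k ℓ := by
        apply FaithfulSMul.algebraMap_injective ℤ R
        rw [P.algebraMap_pairingIn, P.algebraMap_pairingIn, ← P.root_coroot_eq_pairing, hα, theta,
          map_sum, LinearMap.sum_apply, Finset.sum_eq_single k]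
        · rw [P.root_coroot_eq_pairing]
        · intro j hj hjk
          rw [P.root_coroot_eq_pairing]
          refine pairing_eq_zero_of_not_adj b (Finset.ne_of_mem_erase hj) fun ha ↦ ?_
          exact hjk (h.unique j (Finset.mem_of_mem_erase hj) ha.symm)
        · exact fun hk ↦ absurd h.nbr_mem_erase hk
      rw [hpair]
      have h1 := b.cartanMatrix_le_zero_of_ne k ℓ h.ne.symm
      have h2 : b.cartanMatrix k ℓ ≠ 0 := fun h0 ↦
        h.adj.symm.2 (b.cartanMatrix_apply_eq_zero_iff_pairing.mp h0)
      exact lt_of_le_of_ne h1 h2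
    · have h0 := repr_theta b J ℓ
      rw [← hsum, hneg, neg_add_cancel, map_zero, if_pos h.mem] at h0
      exact zero_ne_one h0

end RootPairing.Base

/-! ### Restricted partitions into positive roots -/

namespace RootPairing.Base

variable {ι R M N : Type*} [Field R] [CharZero R] [AddCommGroup M] [Module R M]
  [AddCommGroup N] [Module R N] {P : RootPairing ι R M N} (b : P.Base)

open Classical in
/-- The function on the roots which takes the value `1` at the roots `ϑ_K`, for the blocks `K`
of `π`, and `0` elsewhere. -/
noncomputable def blockIndicator (π : Finset (Finset b.support)) (α : ι) : ℕ :=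
  if ∃ K ∈ π, P.root α = b.theta K then 1 else 0

variable {b}

theorem blockIndicator_ne_zero {π : Finset (Finset b.support)} {α : ι} :
    b.blockIndicator π α ≠ 0 ↔ ∃ K ∈ π, P.root α = b.theta K := by
  simp [blockIndicator]

variable [Fintype ι] [P.IsRootSystem] [P.IsCrystallographic] {μ : M}
  {J : Finset b.support}

theorem blockIndicator_mem {π : Finset (Finset b.support)}
    (hπ : b.dynkinGraph.IsConnectedPartition (b.weightSupport μ) J π) :
    b.blockIndicator π ∈ b.restrictedPartitions μ (b.theta J) := by
  classical
  have hroot : ∀ K ∈ π, ∃ α, b.IsPos α ∧ P.root α = b.theta K := fun K hK ↦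
    exists_root_eq_theta (hπ.conn K hK) <| by
      obtain ⟨s, hs, -⟩ := hπ.meets K hK
      exact ⟨s, hs⟩
  refine ⟨?_, fun α hα ↦ ?_⟩
  · have h1 : ∀ α, b.blockIndicator π α • P.root α =
        ∑ K ∈ π, if P.root α = b.theta K then b.theta K else 0 := fun α ↦ by
      by_cases h : ∃ K ∈ π, P.root α = b.theta K
      · obtain ⟨K, hK, hαK⟩ := h
        rw [blockIndicator, if_pos ⟨K, hK, hαK⟩, one_smul, Finset.sum_eq_single K, if_pos hαK, hαK]
        · intro L _ hLK
          exact if_neg fun h ↦ hLK (b.theta_injective (h.symm.trans hαK))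
        · exact fun h ↦ absurd hK h
      · rw [blockIndicator, if_neg h, zero_smul]
        push Not at h
        exact (Finset.sum_eq_zero fun K hK ↦ if_neg (h K hK)).symm
    have h2 : ∀ K ∈ π, ∑ α, (if P.root α = b.theta K then b.theta K else 0) = b.theta K := by
      intro K hK
      obtain ⟨α, -, hα⟩ := hroot K hK
      rw [Finset.sum_eq_single α, if_pos hα]
      · intro β _ hβ
        exact if_neg fun h ↦ hβ (P.root.injective (h.trans hα.symm))
      · simp
    have hJ : π.biUnion id = J := by
      ext x
      rw [Finset.mem_biUnion]
      exact ⟨fun ⟨K, hK, hx⟩ ↦ hπ.subset K hK hx, fun hx ↦ hπ.cover x hx⟩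
    rw [Finset.sum_congr rfl fun α _ ↦ h1 α, Finset.sum_comm, Finset.sum_congr rfl h2]
    simp only [theta]
    rw [← hJ, Finset.sum_biUnion]
    · rfl
    · intro K hK L hL hKL
      refine Finset.disjoint_left.mpr fun x hxK hxL ↦ hKL ?_
      exact hπ.eq_of_mem K hK L hL x hxK hxL
  · obtain ⟨K, hK, hαK⟩ := blockIndicator_ne_zero.mp hα
    obtain ⟨β, hβ, hβK⟩ := hroot K hK
    obtain rfl := P.root.injective (hαK.trans hβK.symm)
    obtain ⟨s, hs, hsS⟩ := hπ.meets K hK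
    exact ⟨hβ, s, by rwa [hαK, mem_rootSupport_theta], hsS⟩

theorem blockIndicator_injOn :
    Set.InjOn b.blockIndicator (b.dynkinGraph.connectedPartitions (b.weightSupport μ) J) := by
  have key : ∀ π ∈ b.dynkinGraph.connectedPartitions (b.weightSupport μ) J,
      ∀ π', b.blockIndicator π = b.blockIndicator π' → π ⊆ π' := by
    intro π hπ π' h K hK
    obtain ⟨s, hs, -⟩ := hπ.meets K hK
    obtain ⟨α, -, hα⟩ := exists_root_eq_theta (hπ.conn K hK) ⟨s, hs⟩
    obtain ⟨L, hL, hαL⟩ := blockIndicator_ne_zero.mp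
      (congrFun h α ▸ blockIndicator_ne_zero.mpr ⟨K, hK, hα⟩)
    exact b.theta_injective (hα.symm.trans hαL) ▸ hL
  exact fun π hπ π' hπ' h ↦ (key π hπ π' h).antisymm (key π' hπ' π h.symm)

/-- In a partition of `ϑ_J` all multiplicities and all coefficients of the roots that occur are at
most one, so that the partition amounts to a partition of `J` into connected blocks. -/
theorem exists_blockIndicator_eq {ξ : ι → ℕ} (hξ : ξ ∈ b.restrictedPartitions μ (b.theta J)) :
    ∃ π ∈ b.dynkinGraph.connectedPartitions (b.weightSupport μ) J, b.blockIndicator π = ξ := by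
  classical
  obtain ⟨hsum, hpos⟩ := hξ
  choose! c hc hconn using fun (α : ι) (hα : b.IsPos α) ↦ hα.exists_eq_sum_nsmul
  have hcoeff : ∀ j, ∑ α, ξ α * c α j = if j ∈ J then 1 else 0 := fun j ↦ by
    have := congrArg (fun x ↦ b.toWeightBasis.repr x j) hsum
    simp only [repr_theta, map_sum, Finsupp.finsetSum_apply, map_nsmul, Finsupp.smul_apply] at this
    have h2 : ∀ α, ξ α • b.toWeightBasis.repr (P.root α) j = ((ξ α * c α j : ℕ) : R) := fun α ↦ by
      by_cases h0 : ξ α = 0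
      · simp [h0]
      · rw [hc α (hpos α h0).1, repr_sum_nsmul, nsmul_eq_mul, Nat.cast_mul]
    rw [Finset.sum_congr rfl fun α _ ↦ h2 α, ← Nat.cast_sum] at this
    split_ifs at this ⊢ <;> exact_mod_cast this
  have hle : ∀ α j, ξ α * c α j ≤ if j ∈ J then 1 else 0 := fun α j ↦ by
    rw [← hcoeff j]
    exact Finset.single_le_sum (f := fun α ↦ ξ α * c α j) (fun _ _ ↦ Nat.zero_le _)
      (Finset.mem_univ α)
  let supp : ι → Finset b.support := fun α ↦ Finset.univ.filter fun j ↦ c α j ≠ 0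
  have hmem : ∀ α j, j ∈ supp α ↔ c α j ≠ 0 := by simp [supp]
  have hsuppJ : ∀ α, ξ α ≠ 0 → supp α ⊆ J := fun α hα j hj ↦ by
    have h1 := hle α j
    have h2 := Nat.mul_pos (Nat.pos_of_ne_zero hα) (Nat.pos_of_ne_zero ((hmem α j).mp hj))
    by_contra hjJ
    rw [if_neg hjJ] at h1
    omega
  have hle1 : ∀ α j, ξ α * c α j ≤ 1 := fun α j ↦ (hle α j).trans (by split_ifs <;> simp)
  have htheta : ∀ α, ξ α ≠ 0 → P.root α = b.theta (supp α) := fun α hα ↦ by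
    rw [theta_eq_sum, hc α (hpos α hα).1]
    refine Finset.sum_congr rfl fun j _ ↦ congrArg (· • P.root j) ?_
    have h1 := hle1 α j
    have h2 : c α j ≤ ξ α * c α j := Nat.le_mul_of_pos_left _ (Nat.pos_of_ne_zero hα)
    by_cases h0 : c α j = 0
    · rw [if_neg (by simp [hmem, h0]), h0]
    · rw [if_pos ((hmem α j).mpr h0)]
      omega
  have hmeets : ∀ α, ξ α ≠ 0 → ∃ s ∈ supp α, s ∈ b.weightSupport μ := fun α hα ↦ by
    obtain ⟨s, hs, hsS⟩ := (hpos α hα).2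
    rw [htheta α hα, mem_rootSupport_theta] at hs
    exact ⟨s, hs, hsS⟩
  have hone : ∀ α, ξ α ≠ 0 → ξ α = 1 := fun α hα ↦ by
    obtain ⟨s, hs, -⟩ := hmeets α hα
    have h1 := hle1 α s
    have h2 : ξ α ≤ ξ α * c α s :=
      Nat.le_mul_of_pos_right _ (Nat.pos_of_ne_zero ((hmem α s).mp hs))
    omega
  refine ⟨(Finset.univ.filter fun α ↦ ξ α ≠ 0).image supp, ⟨?_, ?_, ?_, ?_, ?_⟩, ?_⟩
  · simpa using hsuppJ
  · simp only [Finset.mem_image, Finset.mem_filter, Finset.mem_univ, true_and]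
    rintro _ ⟨α, hα, rfl⟩
    exact hconn α (hpos α hα).1
  · simpa using hmeets
  · intro j hj
    have h1 := hcoeff j
    rw [if_pos hj] at h1
    obtain ⟨α, -, hα⟩ := Finset.exists_ne_zero_of_sum_ne_zero (h1 ▸ one_ne_zero)
    rw [mul_ne_zero_iff] at hα
    exact ⟨supp α, Finset.mem_image_of_mem _ (by simpa using hα.1), (hmem α j).mpr hα.2⟩
  · simp only [Finset.mem_image, Finset.mem_filter, Finset.mem_univ, true_and]
    rintro _ ⟨α, hα, rfl⟩ _ ⟨β, hβ, rfl⟩ j hjα hjβ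
    by_contra hne
    have hαβ : α ≠ β := fun h ↦ hne (h ▸ rfl)
    -- The coefficient of `j` would be at least two.
    have h1 := Finset.sum_le_sum_of_subset (f := fun α ↦ ξ α * c α j)
      (Finset.subset_univ ({α, β} : Finset ι))
    rw [hcoeff j, Finset.sum_pair hαβ] at h1
    have h2 := Nat.mul_pos (Nat.pos_of_ne_zero hα) (Nat.pos_of_ne_zero ((hmem α j).mp hjα))
    have h3 := Nat.mul_pos (Nat.pos_of_ne_zero hβ) (Nat.pos_of_ne_zero ((hmem β j).mp hjβ))
    split_ifs at h1 <;> omega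
  · ext α
    rw [blockIndicator]
    split_ifs with h
    · simp only [Finset.mem_image, Finset.mem_filter, Finset.mem_univ, true_and] at h
      obtain ⟨_, ⟨β, hβ, rfl⟩, hαβ⟩ := h
      obtain rfl := P.root.injective (hαβ.trans (htheta β hβ).symm)
      exact (hone α hβ).symm
    · by_contra h0
      have h0 : ξ α ≠ 0 := fun h ↦ h0 h.symm
      exact h ⟨supp α, Finset.mem_image_of_mem _ (by simpa using h0), htheta α h0⟩

theorem restrictedPartitions_theta : b.restrictedPartitions μ (b.theta J) =
    b.blockIndicator '' b.dynkinGraph.connectedPartitions (b.weightSupport μ) J := by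
  ext ξ
  exact ⟨exists_blockIndicator_eq, fun ⟨_, hπ, h⟩ ↦ h ▸ blockIndicator_mem hπ⟩

theorem finite_restrictedPartitions_theta : (b.restrictedPartitions μ (b.theta J)).Finite := by
  rw [restrictedPartitions_theta]
  exact SimpleGraph.finite_connectedPartitions.image _

theorem ncard_restrictedPartitions_theta : (b.restrictedPartitions μ (b.theta J)).ncard =
    (b.dynkinGraph.connectedPartitions (b.weightSupport μ) J).ncard := by
  rw [restrictedPartitions_theta, blockIndicator_injOn.ncard_image]

end RootPairing.Base

/-! ### Raising and lowering operators -/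

open SimpleGraph

/-- The vector `F i₁ (F i₂ (⋯ v))` attached to a list `[i₁, i₂, …]`. -/
def lowered {I V : Type*} [AddCommGroup V] [Module ℂ V] (F : I → End ℂ V) (v : V) (w : List I) :
    V :=
  w.foldr (fun i u ↦ F i u) v

/-- The operator `⋯ ∘ E i₂ ∘ E i₁` attached to a list `[i₁, i₂, …]`. -/
def raising {I V : Type*} [AddCommGroup V] [Module ℂ V] (E : I → End ℂ V) : List I → End ℂ V
  | [] => LinearMap.id
  | i :: w => raising E w ∘ₗ E i

/-- Operators `E i`, `F i` behaving like the simple root vectors of a semisimple Lie algebra near a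
highest weight vector `v`, whose weight takes the value `wt i none` on the `i`-th coroot.
For `j ≠ i` the number `wt i (some j)` is the negative of the value of the `j`-th simple root on
the `i`-th coroot. The relation `[E i, F i] = h i` is only required on the lowered vectors not
involving `i`. -/
structure IsRaisingLowering {I V : Type*} [AddCommGroup V] [Module ℂ V] (E F : I → End ℂ V)
    (wt : I → Option I → ℝ) (v : V) : Prop where
  ne_zero : v ≠ 0
  raise : ∀ i, E i v = 0
  comm : ∀ i j, i ≠ j → ∀ u, E i (F j u) = F j (E i u)
  comm_self : ∀ i (w : List I), i ∉ w → E i (F i (lowered F v w)) = F i (E i (lowered F v w)) +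
    ((wt i none : ℂ) + (w.map fun j ↦ (wt i (some j) : ℂ)).sum) • lowered F v w

/-- The span of the vectors obtained by applying each of the operators `F j`, for `j ∈ J`, once. -/
def loweredSpan {I V : Type*} [AddCommGroup V] [Module ℂ V] (F : I → End ℂ V) (v : V)
    (J : Finset I) : Submodule ℂ V :=
  Submodule.span ℂ (Set.range fun τ : Ordering J ↦ lowered F v τ.1)

section

variable {I V : Type*} [AddCommGroup V] [Module ℂ V] {E F : I → End ℂ V} {v : V} {i j : I}
  {w : List I}

@[simp] theorem lowered_nil : lowered F v [] = v := rfl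

@[simp] theorem lowered_cons : lowered F v (i :: w) = F i (lowered F v w) := rfl

@[simp] theorem raising_nil (u : V) : raising E [] u = u := rfl

@[simp] theorem raising_cons (u : V) : raising E (i :: w) u = raising E w (E i u) := rfl

/-- The value which the `i`-th coroot takes on the weight of the vector obtained by applying
those `F j` for which `j` comes after `i` in the list `w`. -/
noncomputable def lowerCoeff [Fintype I] (wt : I → Option I → ℝ) (i : I) (w : List I) : ℂ :=
  ∑ p, (wt i p : ℂ) * precedes i p w

variable {wt : I → Option I → ℝ}

open scoped List in
theorem precedes_cons_of_ne (h : i ≠ j) (p : Option I) : precedes i p (j :: w) =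
    precedes i p w := by
  cases p with
  | none => rfl
  | some k =>
    by_cases hk : [i, k] <+ w
    · rw [precedes_some_of_sublist hk,
        precedes_some_of_sublist ((List.pair_sublist_cons_of_ne h).mpr hk)]
    · rw [precedes_some_of_not_sublist hk,
        precedes_some_of_not_sublist (mt (List.pair_sublist_cons_of_ne h).mp hk)]

open Classical in
theorem precedes_cons_self (h : i ∉ w) (k : I) :
    precedes i (some k) (i :: w) = if k ∈ w then 1 else 0 := by
  simp only [precedes, Option.elim_some, List.pair_sublist_cons_self h]

variable [Fintype I]

open Classical in
theorem lowerCoeff_cons_self (hw : (i :: w).Nodup) : lowerCoeff wt i (i :: w) =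
    (wt i none : ℂ) + (w.map fun j ↦ (wt i (some j) : ℂ)).sum := by
  rw [List.nodup_cons] at hw
  rw [lowerCoeff, Fintype.sum_option, precedes_none, mul_one, ← List.sum_toFinset _ hw.2]
  simp [precedes_cons_self hw.1, ← List.mem_toFinset, Finset.sum_ite_mem]

theorem lowerCoeff_cons_of_ne (hij : i ≠ j) : lowerCoeff wt i (j :: w) = lowerCoeff wt i w := by
  simp only [lowerCoeff, precedes_cons_of_ne hij]

namespace IsRaisingLowering

theorem raise_lowered_of_notMem (h : IsRaisingLowering E F wt v) (hi : i ∉ w) :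
    E i (lowered F v w) = 0 := by
  induction w with
  | nil => exact h.raise i
  | cons j w ih =>
    rw [List.mem_cons, not_or] at hi
    rw [lowered_cons, h.comm i j hi.1, ih hi.2, map_zero]

variable [DecidableEq I] {J : Finset I}

theorem raise_lowered_of_mem (h : IsRaisingLowering E F wt v) (hw : w.Nodup) (hi : i ∈ w) :
    E i (lowered F v w) = lowerCoeff wt i w • lowered F v (w.erase i) := by
  induction w with
  | nil => simp at hi
  | cons j w ih =>
    have hw' := List.nodup_cons.mp hw
    by_cases hij : i = j
    · subst hij
      rw [lowered_cons, h.comm_self i w hw'.1, h.raise_lowered_of_notMem hw'.1, map_zero, zero_add,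
        lowerCoeff_cons_self hw, List.erase_cons_head]
    · rw [lowered_cons, h.comm i j hij, ih hw'.2 ((List.mem_cons.mp hi).resolve_left hij),
        map_smul, lowerCoeff_cons_of_ne hij, List.erase_cons_tail (by simpa using Ne.symm hij),
        lowered_cons]

open scoped List in
/-- The pairing of raising words with lowering words. Each `E i` removes `F i` and contributes the
value of the `i`-th coroot on the weight of the part of the lowered vector to the right of `F i`.
Of the `F j` in this part, those remain that have not been removed before: `j` comes after `i` in
`τ` and in `σ`. -/
theorem raising_lowered (h : IsRaisingLowering E F wt v) {σ τ : List I} (hσ : σ.Nodup)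
    (hτ : τ.Nodup) (hστ : ∀ x, x ∈ τ ↔ x ∈ σ) : raising E σ (lowered F v τ) =
      (σ.map fun i ↦ ∑ p, (wt i p : ℂ) * (precedes i p σ * precedes i p τ)).prod • v := by
  induction σ generalizing τ with
  | nil =>
    obtain rfl : τ = [] := List.eq_nil_iff_forall_not_mem.mpr (by simpa using hστ)
    simp
  | cons i σ ih =>
    have hσ' := List.nodup_cons.mp hσ
    have hiτ : i ∈ τ := (hστ i).mpr (by simp)
    have hmem : ∀ x, x ∈ τ.erase i ↔ x ∈ σ := fun x ↦ by
      rw [hτ.mem_erase_iff, hστ, List.mem_cons]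
      refine ⟨fun hx ↦ hx.2.resolve_left hx.1, fun hx ↦ ⟨?_, Or.inr hx⟩⟩
      rintro rfl
      exact hσ'.1 hx
    rw [raising_cons, h.raise_lowered_of_mem hτ hiτ, map_smul, ih hσ'.2 (hτ.erase i) hmem,
      smul_smul, List.map_cons, List.prod_cons]
    congr 2
    · refine Finset.sum_congr rfl fun p _ ↦ congrArg _ ?_
      cases p with
      | none => simp
      | some j =>
        rw [precedes_cons_self hσ'.1]
        by_cases hj : j ∈ σ
        · rw [if_pos hj, one_mul]
        · rw [if_neg hj, zero_mul]
          refine precedes_some_of_not_sublist fun hs ↦ ?_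
          rcases List.mem_cons.mp ((hστ j).mp (hs.subset (by simp))) with rfl | hj'
          · exact List.not_pair_sublist_of_pair_sublist hτ hs hs
          · exact hj hj'
    · refine congrArg _ (List.map_congr_left fun k hk ↦ ?_)
      have hki : k ≠ i := by
        rintro rfl
        exact hσ'.1 hk
      refine Finset.sum_congr rfl fun p _ ↦ congrArg _ ?_
      rw [precedes_cons_of_ne hki]
      by_cases hp : p = some i
      · subst hp
        rw [precedes_some_of_not_sublist fun hs ↦ hσ'.1 (hs.subset (by simp)), zero_mul, zero_mul]
      · let τ' : Ordering τ.toFinset := ⟨τ, hτ, by simp⟩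
        exact congrArg _ (precedes_erase τ' hki hp)

theorem raise_mem_loweredSpan (h : IsRaisingLowering E F wt v) (hi : i ∈ J) {u : V}
    (hu : u ∈ loweredSpan F v J) : E i u ∈ loweredSpan F v (J.erase i) := by
  have : loweredSpan F v J ≤ (loweredSpan F v (J.erase i)).comap (E i) := by
    rw [loweredSpan, Submodule.span_le]
    rintro _ ⟨τ, rfl⟩
    rw [SetLike.mem_coe, Submodule.mem_comap,
      h.raise_lowered_of_mem τ.2.1 ((τ.2.2 i).mpr hi)]
    exact Submodule.smul_mem _ _ (Submodule.subset_span ⟨τ.erase i, rfl⟩)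
  exact this hu

theorem raise_eq_zero_of_mem_loweredSpan (h : IsRaisingLowering E F wt v) (hi : i ∉ J) {u : V}
    (hu : u ∈ loweredSpan F v J) : E i u = 0 := by
  have : loweredSpan F v J ≤ LinearMap.ker (E i) := by
    rw [loweredSpan, Submodule.span_le]
    rintro _ ⟨τ, rfl⟩
    exact h.raise_lowered_of_notMem (mt (τ.2.2 i).mp hi)
  exact this hu

/-- If no nonzero combination of the lowered vectors is killed by all raising operators, then such
a combination is determined by its pairings with raising words. -/
theorem eq_zero_of_raising_eq_zero (h : IsRaisingLowering E F wt v)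
    (hsing : ∀ J : Finset I, J.Nonempty → ∀ u ∈ loweredSpan F v J, (∀ i, E i u = 0) → u = 0)
    {u : V} (hu : u ∈ loweredSpan F v J) (h0 : ∀ σ : Ordering J, raising E σ.1 u = 0) :
    u = 0 := by
  induction hn : J.card generalizing J u with
  | zero =>
    obtain rfl := Finset.card_eq_zero.mp hn
    exact h0 ⟨[], by simp⟩
  | succ n ih =>
    refine hsing J (Finset.card_pos.mp (by omega)) u hu fun i ↦ ?_
    by_cases hi : i ∈ J
    · refine ih (h.raise_mem_loweredSpan hi hu) (fun σ ↦ ?_) (by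
        rw [Finset.card_erase_of_mem hi, hn, Nat.add_sub_cancel])
      refine h0 ⟨i :: σ.1, List.nodup_cons.mpr ⟨fun hmem ↦ ?_, σ.2.1⟩, fun x ↦ ?_⟩
      · simpa using (σ.2.2 i).mp hmem
      · rw [List.mem_cons, σ.2.2, Finset.mem_erase]
        by_cases hx : x = i <;> simp [hx, hi]
    · exact h.raise_eq_zero_of_mem_loweredSpan hi hu

/-- The Gram matrix of the lowered vectors expands into a sum of rank one matrices with nonnegative
weights, indexed by the functions `p : J → Option I`; those of nonzero weight are the forest
functions of the graph whose edges are given by the support of `wt`. -/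
theorem nonempty_loweredSpan_equiv (h : IsRaisingLowering E F wt v)
    (hsing : ∀ J : Finset I, J.Nonempty → ∀ u ∈ loweredSpan F v J, (∀ i, E i u = 0) → u = 0)
    {G : SimpleGraph I} {S : Set I} (hwt : ∀ i p, 0 ≤ wt i p)
    (hG : ∀ i p, wt i p ≠ 0 ↔ G.IsParent S i p) :
    Nonempty (loweredSpan F v J ≃ₗ[ℂ] G.forestSpan S J) := by
  classical
  obtain ⟨φ, hφ⟩ : ∃ φ : Dual ℂ V, φ v = 1 :=
    Projective.exists_dual_eq_one ℂ h.ne_zero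
  let T : V →ₗ[ℂ] (Ordering J → ℂ) := LinearMap.pi fun σ ↦ φ ∘ₗ raising E σ.1
  let ext : (J → Option I) → I → Option I := fun p i ↦ if hi : i ∈ J then p ⟨i, hi⟩ else none
  let Φ : (J → Option I) → Ordering J → ℂ := fun p ↦ forestFun J (ext p)
  have hΦ : ∀ p σ, Φ p σ = ∏ i : J, precedes i.1 (p i) σ.1 := fun p σ ↦ by
    simp only [Φ, forestFun]
    rw [← Finset.prod_coe_sort]
    exact Finset.prod_congr rfl fun i _ ↦ by simp [ext]
  let W : (J → Option I) → ℝ := fun p ↦ ∏ i : J, wt i (p i)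
  have hgram : ∀ σ τ : Ordering J, raising E σ.1 (lowered F v τ.1) =
      (∑ p, (W p : ℂ) * (Φ p σ * Φ p τ)) • v := fun σ τ ↦ by
    rw [h.raising_lowered σ.2.1 τ.2.1 fun x ↦ (τ.2.2 x).trans (σ.2.2 x).symm,
      ← List.prod_toFinset _ σ.2.1, show σ.1.toFinset = J by ext x; simp [σ.2.2],
      ← Finset.prod_coe_sort, Finset.prod_univ_sum]
    simp only [Fintype.piFinset_univ, hΦ, W, Complex.ofReal_prod, ← Finset.prod_mul_distrib]
  have hT : ∀ τ : Ordering J, T (lowered F v τ.1) = fun σ ↦ ∑ p, (W p : ℂ) * (Φ p σ * Φ p τ) :=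
    fun τ ↦ by
      ext σ
      simp only [T, LinearMap.pi_apply, LinearMap.comp_apply, hgram, map_smul, hφ, smul_eq_mul,
        mul_one]
  have hmap : (loweredSpan F v J).map T = G.forestSpan S J := by
    rw [loweredSpan, Submodule.map_span, ← Set.range_comp,
      show T ∘ (fun τ : Ordering J ↦ lowered F v τ.1) = _ from funext hT,
      span_range_sum_weighted_squares Φ (fun p σ ↦ ?_) W fun p ↦ Finset.prod_nonneg fun i _ ↦
        hwt _ _]
    · rw [forestSpan]
      congr 1
      apply Set.Subset.antisymm
      · rintro _ ⟨p, hp, rfl⟩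
        refine ⟨ext p, fun i hi ↦ ?_, rfl⟩
        rw [← hG]
        have := Finset.prod_ne_zero_iff.mp hp ⟨i, hi⟩ (Finset.mem_univ _)
        simpa [ext, hi] using this
      · rintro _ ⟨p, hp, rfl⟩
        refine ⟨fun i ↦ p i, ?_, ?_⟩
        · exact Finset.prod_ne_zero_iff.mpr fun i _ ↦ (hG _ _).mpr (hp i i.2)
        · exact forestFun_congr fun i hi ↦ by simp [ext, hi]
    · rw [hΦ, star_prod]
      exact Finset.prod_congr rfl fun i _ ↦ star_precedes _ _ _
  -- On the lowered span the raising words take values in the line spanned by `v`.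
  have hval : ∀ u ∈ loweredSpan F v J, ∀ σ : Ordering J, raising E σ.1 u ∈ Submodule.span ℂ {v} :=
    fun u hu σ ↦ by
      have : loweredSpan F v J ≤ (Submodule.span ℂ {v}).comap (raising E σ.1) := by
        rw [loweredSpan, Submodule.span_le]
        rintro _ ⟨τ, rfl⟩
        rw [SetLike.mem_coe, Submodule.mem_comap, hgram]
        exact Submodule.smul_mem _ _ (Submodule.mem_span_singleton_self v)
      exact this hu
  have hinj : Function.Injective (T.domRestrict (loweredSpan F v J)) := by
    rw [← LinearMap.ker_eq_bot, LinearMap.ker_eq_bot']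
    rintro ⟨u, hu⟩ hTu
    refine Subtype.ext (h.eq_zero_of_raising_eq_zero hsing hu fun σ ↦ ?_)
    obtain ⟨c, hc⟩ := Submodule.mem_span_singleton.mp (hval u hu σ)
    have : φ (raising E σ.1 u) = 0 := congrFun hTu σ
    rw [← hc, map_smul, hφ, smul_eq_mul, mul_one] at this
    rw [← hc, this, zero_smul]
  exact ⟨(LinearEquiv.ofInjective _ hinj).trans
    (LinearEquiv.ofEq _ _ ((LinearMap.range_domRestrict _ _).trans hmap))⟩

end IsRaisingLowering

end

/-! ### Generation by the simple root vectors -/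

namespace LieAlgebra.IsKilling

variable {𝔤 : Type*} [LieRing 𝔤] [LieAlgebra ℂ 𝔤] [FiniteDimensional ℂ 𝔤] [IsKilling ℂ 𝔤]
  {H : LieSubalgebra ℂ 𝔤} [H.IsCartanSubalgebra]

theorem exists_smul_eq_of_mem_rootSpace {α : LieModule.Weight ℂ H 𝔤} (hα : α.IsNonZero) {x y : 𝔤}
    (hx : x ∈ rootSpace H α) (hx0 : x ≠ 0) (hy : y ∈ rootSpace H α) : ∃ c : ℂ, c • x = y := by
  have h0 : (⟨x, hx⟩ : rootSpace H α) ≠ 0 := fun h ↦ hx0 (congrArg Subtype.val h)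
  obtain ⟨c, hc⟩ := (finrank_eq_one_iff_of_nonzero' _ h0).mp (finrank_rootSpace_eq_one α hα) ⟨y, hy⟩
  exact ⟨c, congrArg Subtype.val hc⟩

/-- If `α`, `β` and `α + β` are roots, then `[𝔤_β, 𝔤_α]` is nonzero. Otherwise the root vectors for
`α` and, by invariance of the Killing form, for `-(α + β)` are primitive for the `𝔰𝔩₂` attached to
`β`; but the sum of their weights is `-2`. -/
theorem lie_ne_zero_of_add_eq {α β γ : LieModule.Weight ℂ H 𝔤} (hα : α.IsNonZero)
    (hβ : β.IsNonZero) (hγ : (γ : H → ℂ) = β + α) {h e f x : 𝔤} (t : IsSl2Triple h e f)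
    (he : e ∈ rootSpace H β) (hf : f ∈ rootSpace H (-β)) (hx : x ∈ rootSpace H α) (hx0 : x ≠ 0) :
    ⁅e, x⁆ ≠ 0 := by
  intro hex
  have hh := t.h_eq_coroot hβ he hf
  have hweight : ∀ {χ : H → ℂ} {y : 𝔤}, y ∈ rootSpace H χ → ⁅h, y⁆ = χ (coroot β) • y :=
    fun hy ↦ by
      rw [hh]
      exact lie_eq_smul_of_mem_rootSpace hy (coroot β)
  have P : t.HasPrimitiveVectorWith x (α (coroot β)) := ⟨hx0, hweight hx, hex⟩
  obtain ⟨n, hn⟩ := P.exists_nat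
  obtain ⟨z, hz, hz0⟩ := (-γ).exists_ne_zero
  have hez : ⁅e, z⁆ ∈ rootSpace H (-α : H → ℂ) := by
    have := lie_mem_genWeightSpace_of_mem_genWeightSpace he hz
    rwa [LieModule.Weight.coe_neg, hγ, neg_add, add_neg_cancel_left] at this
  have hez0 : ⁅e, z⁆ = 0 := by
    have hker : ⁅e, z⁆ ∈ LinearMap.ker (killingForm ℂ 𝔤) := by
      refine mem_ker_killingForm_of_mem_rootSpace_of_forall_rootSpace_neg ℂ 𝔤 H hez fun y hy ↦ ?_
      rw [neg_neg] at hy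
      obtain ⟨c, rfl⟩ := exists_smul_eq_of_mem_rootSpace hα hx hx0 hy
      rw [map_smul, ← lie_skew, map_neg, LinearMap.neg_apply,
        LieModule.traceForm_apply_lie_apply, hex, map_zero, neg_zero, smul_zero]
    rwa [ker_killingForm_eq_bot, Submodule.mem_bot] at hker
  have P' : t.HasPrimitiveVectorWith z ((-γ) (coroot β)) := ⟨hz0, hweight hz, hez0⟩
  obtain ⟨m, hm⟩ := P'.exists_nat
  rw [LieModule.Weight.coe_neg, Pi.neg_apply, hγ, Pi.add_apply, hn, root_apply_coroot hβ,
    neg_eq_iff_add_eq_zero] at hm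
  norm_cast at hm
  omega

theorem rootSpace_le_of_add_eq {K : LieSubalgebra ℂ 𝔤} {α β γ : LieModule.Weight ℂ H 𝔤}
    (hα : α.IsNonZero) (hβ : β.IsNonZero) (hγ0 : γ.IsNonZero) (hγ : (γ : H → ℂ) = β + α)
    (hαK : ∀ x ∈ rootSpace H α, x ∈ K) (hβK : ∀ x ∈ rootSpace H β, x ∈ K) :
    ∀ x ∈ rootSpace H γ, x ∈ K := by
  intro y hy
  obtain ⟨h, e, f, t, he, hf⟩ := exists_isSl2Triple_of_weight_isNonZero hβ
  obtain ⟨x, hx, hx0⟩ := α.exists_ne_zero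
  have hex : ⁅e, x⁆ ∈ rootSpace H γ := by
    rw [hγ]
    exact lie_mem_genWeightSpace_of_mem_genWeightSpace he hx
  obtain ⟨c, rfl⟩ := exists_smul_eq_of_mem_rootSpace hγ0 hex
    (lie_ne_zero_of_add_eq hα hβ hγ t he hf hx hx0) hy
  exact K.smul_mem _ (K.lie_mem (hβK e he) (hαK x hx))

/-- A subalgebra containing the Cartan subalgebra and the root spaces of the simple roots and of
their negatives is everything. -/
theorem eq_top_of_rootSpace_le (b : (rootSystem H).Base) {K : LieSubalgebra ℂ 𝔤} (hH : H ≤ K)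
    (hpos : ∀ i ∈ b.support, ∀ x ∈ rootSpace H i, x ∈ K)
    (hneg : ∀ i ∈ b.support, ∀ x ∈ rootSpace H (-i : H → ℂ), x ∈ K) : K = ⊤ := by
  have key : ∀ α : H.root, b.IsPos α →
      (∀ x ∈ rootSpace H α, x ∈ K) ∧ ∀ x ∈ rootSpace H (-α : H → ℂ), x ∈ K := by
    intro α hα
    refine hα.induction_on_add (p := fun α ↦
      (∀ x ∈ rootSpace H α, x ∈ K) ∧ ∀ x ∈ rootSpace H (-α : H → ℂ), x ∈ K)
      (fun i hi ↦ ⟨hpos i hi, hneg i hi⟩) ?_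
    intro α β γ hγ hαK hβ
    have hαn := H.isNonZero_coe_root α
    have hβn := H.isNonZero_coe_root β
    have hγn := H.isNonZero_coe_root γ
    have hγ' : (γ : H → ℂ) = (β : H → ℂ) + (α : H → ℂ) := by
      ext x
      rw [add_comm]
      exact LinearMap.congr_fun hγ x
    refine ⟨rootSpace_le_of_add_eq hαn hβn hγn hγ' hαK.1 (hpos β hβ), ?_⟩
    refine rootSpace_le_of_add_eq (α := -α.1) (β := -β.1) (γ := -γ.1) hαn.neg hβn.neg hγn.neg ?_
      hαK.2 (hneg β hβ)
    exact (congrArg Neg.neg hγ').trans (neg_add _ _)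
  rw [eq_top_iff]
  intro x _
  have hx : x ∈ ⨆ χ, rootSpace H χ := by simp [LieModule.iSup_genWeightSpace_eq_top ℂ H 𝔤]
  refine LieSubmodule.iSup_induction _ (motive := (· ∈ K)) hx (fun χ y hy ↦ ?_) K.zero_mem
    fun y z ↦ K.add_mem
  · by_cases hy0 : y = 0
    · exact hy0 ▸ K.zero_mem
    by_cases hχ : χ = 0
    · subst hχ
      have := (eq_rootSpace_zero_iff_isCartan ℂ 𝔤 H).mpr inferInstance
      rw [← this] at hy
      exact hH hy
    let α : LieModule.Weight ℂ H 𝔤 := ⟨χ, fun h ↦ hy0 ((LieSubmodule.eq_bot_iff _).mp h y hy)⟩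
    have hα : α.IsNonZero := hχ
    let α' : H.root := ⟨α, by simpa using hα⟩
    rcases RootPairing.Base.IsPos.or_neg b α' with h | h
    · exact (key α' h).1 y hy
    · have hneg' := (rootSystem H).root_reflectionPerm α' α'
      rw [(rootSystem H).reflection_apply_self] at hneg'
      refine (key _ h).2 y ?_
      convert hy using 2
      ext x
      have := LinearMap.congr_fun hneg' x
      exact neg_eq_iff_eq_neg.mpr this

end LieAlgebra.IsKilling

/-! ### Weight spaces of modules generated by a singular vector -/

namespace LieAlgebra.IsKilling

open LieModule

variable {𝔤 : Type*} [LieRing 𝔤] [LieAlgebra ℂ 𝔤] [FiniteDimensional ℂ 𝔤] [IsKilling ℂ 𝔤]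
  {H : LieSubalgebra ℂ 𝔤} [H.IsCartanSubalgebra]
  {V : Type*} [AddCommGroup V] [Module ℂ V] [LieRingModule 𝔤 V] [LieModule ℂ 𝔤 V]

theorem lie_mem_weightSpace {χ ψ : H → ℂ} {x : 𝔤} {u : V} (hx : x ∈ rootSpace H χ)
    (hu : u ∈ weightSpace V ψ) : ⁅x, u⁆ ∈ weightSpace V (ψ + χ) := by
  rw [mem_weightSpace] at hu ⊢
  intro h
  have h1 := lie_eq_smul_of_mem_rootSpace hx h
  have h2 := hu h
  rw [LieSubalgebra.coe_bracket_of_module] at h1 h2 ⊢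
  rw [leibniz_lie, h1, h2, smul_lie, lie_smul, Pi.add_apply, add_smul, add_comm]

/-- A choice of simple root vectors: an `𝔰𝔩₂`-triple for every simple root. -/
structure SimpleRootVectors (b : (rootSystem H).Base) where
  /-- The coroots. -/
  h : b.support → 𝔤
  /-- The positive root vectors. -/
  e : b.support → 𝔤
  /-- The negative root vectors. -/
  f : b.support → 𝔤
  triple : ∀ i : b.support, IsSl2Triple (h i) (e i) (f i)
  e_mem : ∀ i : b.support, e i ∈ rootSpace H i.1
  f_mem : ∀ i : b.support, f i ∈ rootSpace H (-i.1 : H → ℂ)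

theorem nonempty_simpleRootVectors (b : (rootSystem H).Base) : Nonempty (SimpleRootVectors b) := by
  choose h e f t he hf using fun i : b.support ↦
    exists_isSl2Triple_of_weight_isNonZero (H.isNonZero_coe_root i.1)
  exact ⟨⟨h, e, f, t, he, hf⟩⟩

namespace SimpleRootVectors

variable {b : (rootSystem H).Base} (t : SimpleRootVectors b)

theorem h_eq (i : b.support) : t.h i = ((coroot i.1.1 : H) : 𝔤) :=
  (t.triple i).h_eq_coroot (H.isNonZero_coe_root i.1) (t.e_mem i) (t.f_mem i)

theorem lie_e_f_of_ne {i j : b.support} (hij : i ≠ j) : ⁅t.e i, t.f j⁆ = 0 := by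
  by_contra h0
  have hmem := lie_mem_genWeightSpace_of_mem_genWeightSpace (t.e_mem i) (t.f_mem j)
  let γ : Weight ℂ H 𝔤 := ⟨_, fun h ↦ h0 ((LieSubmodule.eq_bot_iff _).mp h _ hmem)⟩
  have hγ : γ.IsNonZero := fun h ↦ by
    have h1 : (rootSystem H).root i = (rootSystem H).root j := by
      ext x
      exact add_neg_eq_zero.mp (congrFun h x)
    exact hij (Subtype.ext ((rootSystem H).root.injective h1))
  refine b.sub_notMem_range_root i.2 j.2 ⟨⟨γ, by simpa using hγ⟩, ?_⟩
  ext x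
  exact (sub_eq_add_neg _ _).symm

variable (V) in
/-- The action of the positive simple root vectors. -/
def E (i : b.support) : End ℂ V := toEnd ℂ 𝔤 V (t.e i)

variable (V) in
/-- The action of the negative simple root vectors. -/
def F (i : b.support) : End ℂ V := toEnd ℂ 𝔤 V (t.f i)

theorem E_apply (i : b.support) (u : V) : t.E V i u = ⁅t.e i, u⁆ := rfl

theorem F_apply (i : b.support) (u : V) : t.F V i u = ⁅t.f i, u⁆ := rfl

variable {ν : Dual ℂ H} {u : V}

theorem lowered_mem_weightSpace (hu : u ∈ weightSpace V ν) (w : List b.support) :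
    lowered (t.F V) u w ∈
      weightSpace V (ν - (w.map fun i : b.support ↦ (rootSystem H).root i).sum : Dual ℂ H) := by
  induction w with
  | nil => simpa using hu
  | cons i w ih =>
    rw [lowered_cons, F_apply]
    convert lie_mem_weightSpace (t.f_mem i) ih using 2
    ext x
    simp only [List.map_cons, List.sum_cons, LinearMap.sub_apply, LinearMap.add_apply,
      Pi.add_apply, Pi.neg_apply]
    change _ - (_ + _) = _ - _ + -(rootSystem H).root i x
    ring

theorem comm (i j : b.support) (hij : i ≠ j) (u : V) :
    t.E V i (t.F V j u) = t.F V j (t.E V i u) := by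
  rw [E_apply, F_apply, leibniz_lie, t.lie_e_f_of_ne hij, zero_lie, zero_add]
  rfl

theorem comm_self (hu : u ∈ weightSpace V ν) (i : b.support) :
    t.E V i (t.F V i u) = t.F V i (t.E V i u) + ν (coroot i.1.1) • u := by
  rw [E_apply, F_apply, leibniz_lie, (t.triple i).lie_e_f, t.h_eq, add_comm]
  congr 1
  exact (mem_weightSpace _ _).mp hu _

/-- The words in the negative simple root vectors applied to a singular vector span an irreducible
module. -/
theorem span_lowered [IsIrreducible ℂ 𝔤 V] (hu : u ∈ weightSpace V ν) (hu0 : u ≠ 0)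
    (hsing : ∀ i, t.E V i u = 0) :
    Submodule.span ℂ (Set.range (lowered (t.F V) u)) = ⊤ := by
  set N := Submodule.span ℂ (Set.range (lowered (t.F V) u)) with hN
  have hmem : ∀ w, lowered (t.F V) u w ∈ N := fun w ↦ Submodule.subset_span ⟨w, rfl⟩
  let K : LieSubalgebra ℂ 𝔤 :=
    { carrier := {x | ∀ n ∈ N, ⁅x, n⁆ ∈ N}
      add_mem' := fun hx hy n hn ↦ by
        rw [add_lie]
        exact N.add_mem (hx n hn) (hy n hn)
      zero_mem' := fun n _ ↦ by
        rw [zero_lie]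
        exact N.zero_mem
      smul_mem' := fun c x hx n hn ↦ by
        rw [smul_lie]
        exact N.smul_mem _ (hx n hn)
      lie_mem' := fun {x y} hx hy n hn ↦ by
        rw [lie_lie]
        exact N.sub_mem (hx _ (hy n hn)) (hy _ (hx n hn)) }
  have hK : ∀ x, (∀ w, ⁅x, lowered (t.F V) u w⁆ ∈ N) → x ∈ K := fun x hx n hn ↦ by
    have : N ≤ N.comap (toEnd ℂ 𝔤 V x) := by
      rw [hN, Submodule.span_le]
      rintro _ ⟨w, rfl⟩
      exact hx w
    exact this hn
  have hKe : ∀ i, t.e i ∈ K := fun i ↦ hK _ fun w ↦ by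
    induction w with
    | nil =>
      rw [lowered_nil, ← E_apply, hsing]
      exact N.zero_mem
    | cons j w ih =>
      have hF : t.F V j (t.E V i (lowered (t.F V) u w)) ∈ N := by
        have : N ≤ N.comap (t.F V j) := by
          rw [hN, Submodule.span_le]
          rintro _ ⟨w', rfl⟩
          exact hmem (j :: w')
        exact this ih
      rw [lowered_cons, ← E_apply]
      by_cases hij : i = j
      · subst hij
        rw [t.comm_self (t.lowered_mem_weightSpace hu w)]
        exact N.add_mem hF (N.smul_mem _ (hmem w))
      · rw [t.comm i j hij]
        exact hF
  have htop : K = ⊤ := by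
    refine eq_top_of_rootSpace_le b (fun x hx ↦ ?_) (fun i hi x hx ↦ ?_) fun i hi x hx ↦ ?_
    · refine hK x fun w ↦ ?_
      have := (mem_weightSpace _ _).mp (t.lowered_mem_weightSpace hu w) ⟨x, hx⟩
      rw [LieSubalgebra.coe_bracket_of_module] at this
      rw [this]
      exact N.smul_mem _ (hmem w)
    · obtain ⟨c, rfl⟩ := exists_smul_eq_of_mem_rootSpace (H.isNonZero_coe_root i)
        (t.e_mem ⟨i, hi⟩) (t.triple ⟨i, hi⟩).e_ne_zero hx
      exact K.smul_mem _ (hKe _)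
    · obtain ⟨c, rfl⟩ := exists_smul_eq_of_mem_rootSpace (α := -i.1) (H.isNonZero_coe_root i).neg
        (t.f_mem ⟨i, hi⟩) (t.triple ⟨i, hi⟩).f_ne_zero hx
      exact K.smul_mem _ (hK _ fun w ↦ hmem (⟨i, hi⟩ :: w))
  let N' : LieSubmodule ℂ 𝔤 V :=
    { N with lie_mem := fun {x n} hn ↦ (htop ▸ LieSubalgebra.mem_top x : x ∈ K) n hn }
  have hN' : Nontrivial N' := ⟨⟨u, hmem []⟩, 0, fun h ↦ hu0 (congrArg Subtype.val h)⟩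
  exact congrArg LieSubmodule.toSubmodule N'.eq_top_of_isIrreducible

/-- Every weight space of an irreducible module is spanned by words in the negative simple root
vectors applied to a singular vector. -/
theorem weightSpace_eq_span [IsIrreducible ℂ 𝔤 V] (hu : u ∈ weightSpace V ν) (hu0 : u ≠ 0)
    (hsing : ∀ i, t.E V i u = 0) (κ : Dual ℂ H) :
    (weightSpace V κ).toSubmodule = Submodule.span ℂ (lowered (t.F V) u ''
      {w | ν - (w.map fun i : b.support ↦ (rootSystem H).root i).sum = κ}) := by
  let W : Dual ℂ H → Submodule ℂ V := fun κ ↦ Submodule.span ℂ (lowered (t.F V) u ''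
      {w | ν - (w.map fun i : b.support ↦ (rootSystem H).root i).sum = κ})
  have hle : W ≤ fun κ : Dual ℂ H ↦ (weightSpace V κ).toSubmodule := by
    intro κ
    simp only [W]
    rw [Submodule.span_le]
    rintro _ ⟨w, rfl, rfl⟩
    exact t.lowered_mem_weightSpace hu w
  have hsup : iSup W = ⊤ := by
    rw [eq_top_iff, ← t.span_lowered hu hu0 hsing, Submodule.span_le]
    rintro _ ⟨w, rfl⟩
    exact Submodule.mem_iSup_of_mem _ (Submodule.subset_span ⟨w, rfl, rfl⟩)
  have hind : iSupIndep fun κ : Dual ℂ H ↦ (weightSpace V κ).toSubmodule := by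
    have h1 := LieSubmodule.iSupIndep_toSubmodule.mpr (iSupIndep_genWeightSpace ℂ H V)
    exact (h1.mono fun χ ↦ weightSpace_le_genWeightSpace V χ).comp
      (f := fun κ : Dual ℂ H ↦ (κ : H → ℂ)) DFunLike.coe_injective
  exact (congrFun ((hind.le_iff_eq_of_iSup_eq_top hsup).mp hle) κ).symm

end SimpleRootVectors

end LieAlgebra.IsKilling

/-! ### Diagrams of types `D` and `E` -/

namespace RootPairing.Base

variable {ι R M N : Type*} [Field R] [CharZero R] [AddCommGroup M] [Module R M]
  [AddCommGroup N] [Module R N] {P : RootPairing ι R M N} {b : P.Base}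

variable [Finite ι] {J : Finset b.support}

theorem notMem_boundary {i k l : b.support} (hk : k ∈ J) (hl : l ∈ J) (hkl : k ≠ l)
    (hik : b.dynkinGraph.Adj i k) (hil : b.dynkinGraph.Adj i l) : i ∉ b.boundary J := by
  intro hi
  have h : ({k, l} : Set b.support) ⊆ {m | m ∈ (J : Set b.support) ∧ b.dynkinGraph.Adj i m} := by
    rintro m (rfl | rfl)
    exacts [⟨hk, hik⟩, ⟨hl, hil⟩]
  have h1 := Set.ncard_le_ncard h (Set.toFinite _)
  rw [Set.ncard_pair hkl] at h1
  have := hi.2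
  omega

open Classical in
/-- A three-element set of boundary nodes consists of all the end nodes of a diagram with only
three end nodes. -/
theorem mem_iff_of_subset_boundary {n : ℕ} {f : ℕ → b.support}
    (hf : ∀ a < n, ∀ c < n, f a = f c → a = c) {S : Set b.support} {p q r : ℕ}
    (hS : S ∩ ((Finset.range n).image f : Finset b.support) ⊆
      b.boundary ((Finset.range n).image f : Finset b.support))
    (hcard : (S ∩ ((Finset.range n).image f : Finset b.support)).ncard = 3)
    (hnbr : ∀ a < n, ¬ (a = p ∨ a = q ∨ a = r) → ∃ c < n, ∃ d < n, c ≠ d ∧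
      b.dynkinGraph.Adj (f a) (f c) ∧ b.dynkinGraph.Adj (f a) (f d)) :
    ∀ a < n, f a ∈ S ↔ a = p ∨ a = q ∨ a = r := by
  have hmem : ∀ a < n, f a ∈ (Finset.range n).image f := fun a ha ↦
    Finset.mem_image_of_mem _ (Finset.mem_range.mpr ha)
  have hleft : ∀ a < n, f a ∈ S → a = p ∨ a = q ∨ a = r := fun a ha haS ↦ by
    by_contra hne
    obtain ⟨c, hc, d, hd, hcd, hac, had⟩ := hnbr a ha hne
    exact notMem_boundary (hmem c hc) (hmem d hd) (fun h ↦ hcd (hf c hc d hd h)) hac had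
      (hS ⟨haS, hmem a ha⟩)
  have hsub : S ∩ ((Finset.range n).image f : Finset b.support) ⊆ {f p, f q, f r} := by
    rintro _ ⟨hxS, hx⟩
    obtain ⟨a, ha, rfl⟩ := Finset.mem_image.mp (Finset.mem_coe.mp hx)
    rcases hleft a (Finset.mem_range.mp ha) hxS with rfl | rfl | rfl <;> simp
  have hle : ({f p, f q, f r} : Set b.support).ncard ≤ 3 := by
    refine (Set.ncard_insert_le _ _).trans (Nat.succ_le_succ ?_)
    exact (Set.ncard_insert_le _ _).trans (by rw [Set.ncard_singleton])
  have heq := Set.eq_of_subset_of_ncard_le hsub (hle.trans hcard.ge) (Set.toFinite _)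
  refine fun a ha ↦ ⟨hleft a ha, fun h ↦ ?_⟩
  have : f a ∈ ({f p, f q, f r} : Set b.support) := by
    rcases h with rfl | rfl | rfl <;> simp
  rw [← heq] at this
  exact this.1

variable [P.IsCrystallographic]

open Classical in
/-- The nodes of a diagram of given Cartan type, labelled by natural numbers instead of elements of
`Fin n`. -/
theorem HasCartanType.exists_labelling {n : ℕ} {A : Matrix (Fin n) (Fin n) ℤ} (hn : 0 < n)
    (h : b.HasCartanType J A) : ∃ f : ℕ → b.support, (∀ a < n, ∀ c < n, f a = f c → a = c) ∧
      (Finset.range n).image f = J ∧ ∀ a (ha : a < n) c (hc : c < n),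
        b.dynkinGraph.Adj (f a) (f c) ↔ a ≠ c ∧ A ⟨a, ha⟩ ⟨c, hc⟩ ≠ 0 := by
  obtain ⟨e, he⟩ := h
  let f : ℕ → b.support := fun a ↦ if ha : a < n then e.symm ⟨a, ha⟩ else e.symm ⟨0, hn⟩
  have hf : ∀ a (ha : a < n), f a = e.symm ⟨a, ha⟩ := fun a ha ↦ dif_pos ha
  have hinj : ∀ a < n, ∀ c < n, f a = f c → a = c := fun a ha c hc hac ↦ by
    rw [hf a ha, hf c hc] at hac
    simpa using e.symm.injective (Subtype.ext hac)
  refine ⟨f, hinj, ?_, fun a ha c hc ↦ ?_⟩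
  · ext j
    simp only [Finset.mem_image, Finset.mem_range]
    constructor
    · rintro ⟨a, ha, rfl⟩
      rw [hf a ha]
      exact (e.symm ⟨a, ha⟩).2
    · intro hj
      refine ⟨e ⟨j, hj⟩, (e ⟨j, hj⟩).2, ?_⟩
      rw [hf _ (e ⟨j, hj⟩).2]
      simp
  · have h1 := he (e.symm ⟨a, ha⟩) (e.symm ⟨c, hc⟩)
    rw [e.apply_symm_apply, e.apply_symm_apply, ← hf, ← hf] at h1
    rw [adj_iff_pairing, ← h1, Ne, Ne, Ne, Ne, b.cartanMatrix_apply_eq_zero_iff_pairing]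
    refine and_congr_left' (not_congr ⟨hinj a ha c hc, fun h ↦ h ▸ rfl⟩)

variable {S : Set b.support}

theorem HasTypeD.ncard_connectedPartitions {n : ℕ} (h : b.HasTypeD J n)
    (hS : S ∩ J ⊆ b.boundary J) (hcard : (S ∩ J).ncard = 3) :
    (b.dynkinGraph.connectedPartitions S J).ncard = 3 * (n - 2) + 1 := by
  classical
  obtain ⟨hn, h⟩ := h
  obtain ⟨f, hf, rfl, hA⟩ := h.exists_labelling (by omega)
  have hadj : ∀ a < n, ∀ c < n,
      b.dynkinGraph.Adj (f a) (f c) ↔ SimpleGraph.AdjD n a c := fun a ha c hc ↦ by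
    rw [hA a ha c hc, SimpleGraph.AdjD, CartanMatrix.D, Matrix.of_apply]
    simp only [Fin.mk.injEq]
    split_ifs <;> simp <;> omega
  refine SimpleGraph.ncard_connectedPartitions_typeD hn f hf hadj
    fun a ha ↦ (mem_iff_of_subset_boundary (p := 0) (q := n - 2) (r := n - 1) hf hS hcard
      (fun a ha hne ↦ ?_) a ha).trans (by omega)
  refine ⟨a - 1, by omega, a + 1, by omega, by omega, ?_, ?_⟩
  · rw [hadj a ha _ (by omega), SimpleGraph.AdjD]
    omega
  · rw [hadj a ha _ (by omega), SimpleGraph.AdjD]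
    omega

/-- The edges of the diagrams of type `E`, read off from the Cartan matrices. The matrix is turned
into a function by `Matrix.of.symm`, which the decision procedure can evaluate. -/
theorem HasTypeE.exists_hasCartanType {n : ℕ} (h : b.HasTypeE J n) :
    6 ≤ n ∧ ∃ A : Matrix (Fin n) (Fin n) ℤ, b.HasCartanType J A ∧
      ∀ a c : Fin n, a.1 ≠ c.1 ∧ Matrix.of.symm A a c ≠ 0 ↔ SimpleGraph.AdjE a c := by
  rcases h with ⟨rfl, h⟩ | ⟨rfl, h⟩ | ⟨rfl, h⟩
  · exact ⟨by norm_num, _, h, by decide⟩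
  · exact ⟨by norm_num, _, h, by decide⟩
  · exact ⟨by norm_num, _, h, by decide⟩

theorem HasTypeE.ncard_connectedPartitions {n : ℕ} (h : b.HasTypeE J n)
    (hS : S ∩ J ⊆ b.boundary J) (hcard : (S ∩ J).ncard = 3) :
    (b.dynkinGraph.connectedPartitions S J).ncard = 4 * (n - 2) - 2 := by
  classical
  obtain ⟨hn, f, hf, rfl, hadj⟩ : 6 ≤ n ∧ ∃ f : ℕ → b.support,
      (∀ a < n, ∀ c < n, f a = f c → a = c) ∧ (Finset.range n).image f = J ∧
      ∀ a < n, ∀ c < n, b.dynkinGraph.Adj (f a) (f c) ↔ SimpleGraph.AdjE a c := by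
    obtain ⟨hn, A, h, hA⟩ := h.exists_hasCartanType
    obtain ⟨f, hf, hJ, hf'⟩ := h.exists_labelling (by omega)
    exact ⟨hn, f, hf, hJ, fun a ha c hc ↦ (hf' a ha c hc).trans (hA ⟨a, ha⟩ ⟨c, hc⟩)⟩
  refine SimpleGraph.ncard_connectedPartitions_typeE hn f hf hadj fun a ha ↦
    (mem_iff_of_subset_boundary (p := 0) (q := 1) (r := n - 1) hf hS hcard
      (fun a ha hne ↦ ?_) a ha).trans (by omega)
  -- The neighbours of the node `a` are `a - 1` and `a + 1`, up to the exceptional numbering of the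
  -- nodes near the branch node `3`.
  refine ⟨if a = 2 then 0 else a - 1, by split_ifs <;> omega, if a = 3 then 1 else a + 1,
    by split_ifs <;> omega, by split_ifs <;> omega, ?_, ?_⟩
  · rw [hadj a ha _ (by split_ifs <;> omega), SimpleGraph.AdjE]
    split_ifs <;> omega
  · rw [hadj a ha _ (by split_ifs <;> omega), SimpleGraph.AdjE]
    split_ifs <;> omega

end RootPairing.Base

/-! ### Weight multiplicities -/

namespace LieAlgebra.IsKilling.SimpleRootVectors

open LieModule RootPairing.Base SimpleGraph

variable {𝔤 : Type*} [LieRing 𝔤] [LieAlgebra ℂ 𝔤] [FiniteDimensional ℂ 𝔤] [IsKilling ℂ 𝔤]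
  {H : LieSubalgebra ℂ 𝔤} [H.IsCartanSubalgebra]
  {V : Type*} [AddCommGroup V] [Module ℂ V] [LieRingModule 𝔤 V] [LieModule ℂ 𝔤 V]
  {b : (rootSystem H).Base} (t : SimpleRootVectors b) {μ : Dual ℂ H} {v : V}

/-- The weights with which the parents of a node `i` occur: the value of `μ` on the coroot `h_i`
for `none`, and the negatives of the entries of the Cartan matrix for the neighbours of `i`. -/
noncomputable def parentWeight (b : (rootSystem H).Base) (m : b.support → ℕ) (i : b.support) :
    Option b.support → ℝ
  | none => m i
  | some j => by classical exact if i = j then 0 else -(b.cartanMatrix j i : ℝ)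

theorem parentWeight_some_of_ne {m : b.support → ℕ} {i j : b.support} (hij : i ≠ j) :
    parentWeight b m i (some j) = -(b.cartanMatrix j i : ℝ) := if_neg hij

theorem parentWeight_nonneg (m : b.support → ℕ) (i : b.support) (p : Option b.support) :
    0 ≤ parentWeight b m i p := by
  cases p with
  | none => exact Nat.cast_nonneg _
  | some j =>
    by_cases hij : i = j
    · exact (if_pos hij).ge
    · rw [parentWeight_some_of_ne hij, neg_nonneg]
      exact_mod_cast b.cartanMatrix_le_zero_of_ne j i (Ne.symm hij)

theorem parentWeight_ne_zero {m : b.support → ℕ} (hm : ∀ i : b.support, μ (coroot i.1.1) = m i)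
    (i : b.support) (p : Option b.support) :
    parentWeight b m i p ≠ 0 ↔ b.dynkinGraph.IsParent (b.weightSupport μ) i p := by
  cases p with
  | none =>
    have h1 : i ∈ b.weightSupport μ ↔ μ (coroot i.1.1) ≠ 0 := Iff.rfl
    exact (by rw [h1, hm, parentWeight]; norm_cast :
      parentWeight b m i none ≠ 0 ↔ i ∈ b.weightSupport μ)
  | some j =>
    change _ ↔ b.dynkinGraph.Adj i j
    by_cases hij : i = j
    · subst hij
      simp [parentWeight]
    · rw [parentWeight_some_of_ne hij, neg_ne_zero, Int.cast_ne_zero,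
        b.dynkinGraph.adj_comm, adj_iff_pairing, Ne, b.cartanMatrix_apply_eq_zero_iff_pairing]
      exact (and_iff_right (Ne.symm hij)).symm

/-- The simple root vectors act as raising and lowering operators on a singular vector. In
`[e_i, f_i] = h_i`, the coroot `h_i` takes the value `μ(h_i) - ∑ α_j(h_i)` on a lowered vector. -/
theorem isRaisingLowering {m : b.support → ℕ}
    (hm : ∀ i : b.support, μ (coroot i.1.1) = m i) (hv : v ∈ weightSpace V μ) (hv0 : v ≠ 0)
    (hsing : ∀ i, t.E V i v = 0) :
    IsRaisingLowering (t.E V) (t.F V) (parentWeight b m) v where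
  ne_zero := hv0
  raise := hsing
  comm := t.comm
  comm_self i w hi := by
    rw [t.comm_self (t.lowered_mem_weightSpace hv w)]
    congr 2
    rw [LinearMap.sub_apply, hm, sub_eq_add_neg]
    congr 1
    induction w with
    | nil => simp
    | cons j w ih =>
      rw [List.mem_cons, not_or] at hi
      have hj : (rootSystem H).root j (coroot i.1.1) = (b.cartanMatrix j i : ℂ) :=
        ((rootSystem H).algebraMap_pairingIn ℤ j i).symm
      rw [List.map_cons, List.sum_cons, LinearMap.add_apply, neg_add, ih hi.2, List.map_cons,
        List.sum_cons, hj, parentWeight_some_of_ne hi.1]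
      push_cast
      rfl

theorem weightSpace_eq_loweredSpan [IsIrreducible ℂ 𝔤 V] (hv : v ∈ weightSpace V μ) (hv0 : v ≠ 0)
    (hsing : ∀ i, t.E V i v = 0) (J : Finset b.support) :
    (weightSpace V (μ - b.theta J : Dual ℂ H)).toSubmodule = loweredSpan (t.F V) v J := by
  rw [t.weightSpace_eq_span hv hv0 hsing, loweredSpan]
  congr 1
  ext x
  simp only [sub_right_inj, Set.mem_image, Set.mem_ofPred_eq, Set.mem_range, Subtype.exists,
    list_sum_eq_theta_iff, exists_prop]

/-- A singular vector of weight `μ - ϑ_J` generates the whole module, which then cannot contain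
a vector of the higher weight `μ`. -/
theorem eq_zero_of_singular [IsIrreducible ℂ 𝔤 V] (hv : v ∈ weightSpace V μ) (hv0 : v ≠ 0)
    {J : Finset b.support} (hJ : J.Nonempty) {u : V}
    (hu : u ∈ weightSpace V (μ - b.theta J : Dual ℂ H)) (hsing : ∀ i, t.E V i u = 0) : u = 0 := by
  classical
  by_contra hu0
  have h := t.weightSpace_eq_span hu hu0 hsing μ
  have hempty : {w : List b.support | (μ - b.theta J) -
      (w.map fun i : b.support ↦ (rootSystem H).root i).sum = μ} = ∅ := by
    refine Set.eq_empty_of_forall_notMem fun w hw ↦ ?_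
    obtain ⟨j, hj⟩ := hJ
    have h1 : b.theta J + (w.map fun i : b.support ↦ (rootSystem H).root i).sum = 0 := by
      rw [Set.mem_ofPred_eq, sub_sub, sub_eq_self] at hw
      exact hw
    have h2 := congrArg (fun x ↦ b.toWeightBasis.repr x j) h1
    simp only [map_add, Finsupp.add_apply, repr_theta, if_pos hj, repr_list_sum, map_zero,
      Finsupp.coe_zero, Pi.zero_apply] at h2
    norm_cast at h2
    omega
  rw [hempty, Set.image_empty, Submodule.span_empty] at h
  have : v ∈ (weightSpace V μ).toSubmodule := hv
  rw [h, Submodule.mem_bot] at this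
  exact hv0 this

/-- The weight space of weight `μ - ϑ_J` is isomorphic to the span of the functions attached to
the forests on `J` with roots in the support of `μ`. -/
theorem nonempty_weightSpace_equiv [IsIrreducible ℂ 𝔤 V] (hμ : b.IsDominantIntegral μ)
    (hv : v ∈ weightSpace V μ) (hv0 : v ≠ 0) (hsing : ∀ i, t.E V i v = 0) (J : Finset b.support) :
    Nonempty (weightSpace V (μ - b.theta J : Dual ℂ H) ≃ₗ[ℂ]
      b.dynkinGraph.forestSpan (b.weightSupport μ) J) := by
  classical
  choose m hm using hμ
  obtain ⟨e⟩ := (t.isRaisingLowering hm hv hv0 hsing).nonempty_loweredSpan_equiv (J := J)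
    (fun K hK u hu h0 ↦ t.eq_zero_of_singular hv hv0 hK (by
      rw [← LieSubmodule.mem_toSubmodule, t.weightSpace_eq_loweredSpan hv hv0 hsing]
      exact hu) h0) (parentWeight_nonneg m) (parentWeight_ne_zero hm)
  exact ⟨(LinearEquiv.ofEq _ _ (t.weightSpace_eq_loweredSpan hv hv0 hsing J)).trans e⟩

end LieAlgebra.IsKilling.SimpleRootVectors

open RootPairing.Base SimpleGraph in
/-- The multiplicity of the weight `μ - ϑ_J`, for connected `J`, is the number of partitions of `J`
into connected blocks meeting the support of `μ`. -/
theorem IsIrreducibleOfHighestWeight.finrank_weightSpace {𝔤 : Type*} [LieRing 𝔤] [LieAlgebra ℂ 𝔤]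
    [FiniteDimensional ℂ 𝔤] [LieAlgebra.IsKilling ℂ 𝔤] {H : LieSubalgebra ℂ 𝔤}
    [H.IsCartanSubalgebra] {b : (LieAlgebra.IsKilling.rootSystem H).Base} {μ : Dual ℂ H}
    {V : Type*} [AddCommGroup V] [Module ℂ V] [LieRingModule 𝔤 V] [LieModule ℂ 𝔤 V]
    (hV : IsIrreducibleOfHighestWeight b μ V) (hμ : b.IsDominantIntegral μ)
    {J : Finset b.support} (hJ : b.IsConnectedSub J) :
    FiniteDimensional ℂ (LieModule.weightSpace V (μ - b.theta J : Dual ℂ H)) ∧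
      finrank ℂ (LieModule.weightSpace V (μ - b.theta J : Dual ℂ H)) =
        (b.dynkinGraph.connectedPartitions (b.weightSupport μ) J).ncard := by
  classical
  obtain ⟨hirr, v, hv0, hv, hpos⟩ := hV
  obtain ⟨t⟩ := LieAlgebra.IsKilling.nonempty_simpleRootVectors b
  obtain ⟨e⟩ := t.nonempty_weightSpace_equiv hμ
    ((LieModule.mem_weightSpace _ _).mpr fun h ↦ hv h) hv0
    (fun i ↦ hpos i.1 (isPos_of_mem_support i.2) _ (t.e_mem i)) J
  refine ⟨Module.Finite.equiv e.symm, ?_⟩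
  rw [e.finrank_eq, finrank_forestSpan b.hasLeaves_dynkinGraph (cutConnected_iff.mpr hJ)]

open RootPairing.Base SimpleGraph in
theorem proposition3p1 {𝔤 : Type*} [LieRing 𝔤] [LieAlgebra ℂ 𝔤] [FiniteDimensional ℂ 𝔤]
    [LieAlgebra.IsSimple ℂ 𝔤] (H : LieSubalgebra ℂ 𝔤) [H.IsCartanSubalgebra]
    (b : (LieAlgebra.IsKilling.rootSystem H).Base)
    (μ : Module.Dual ℂ H) (hμ : b.IsDominantIntegral μ)
    (J : Finset b.support) (hJ : b.IsConnectedSub J)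
    (hsupp : b.weightSupport μ ∩ J ⊆ b.boundary J)
    {V : Type*} [AddCommGroup V] [Module ℂ V] [LieRingModule 𝔤 V] [LieModule ℂ 𝔤 V]
    (hV : IsIrreducibleOfHighestWeight b μ V) :
    ((b.restrictedPartitions μ (b.theta J)).Finite ∧
      FiniteDimensional ℂ (LieModule.weightSpace V (μ - b.theta J : Module.Dual ℂ H)) ∧
      Module.finrank ℂ (LieModule.weightSpace V (μ - b.theta J : Module.Dual ℂ H)) =
        (b.restrictedPartitions μ (b.theta J)).ncard) ∧
    ((b.weightSupport μ ∩ J).ncard = 1 →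
      (b.restrictedPartitions μ (b.theta J)).ncard = 1) ∧
    ((b.weightSupport μ ∩ J).ncard = 2 →
      (b.restrictedPartitions μ (b.theta J)).ncard =
        (b.connectedHull (b.weightSupport μ ∩ J)).ncard) ∧
    (∀ n : ℕ, (b.weightSupport μ ∩ J).ncard = 3 → b.HasTypeD J n →
      (b.restrictedPartitions μ (b.theta J)).ncard = 3 * (n - 2) + 1) ∧
    (∀ n : ℕ, (b.weightSupport μ ∩ J).ncard = 3 → b.HasTypeE J n →
      (b.restrictedPartitions μ (b.theta J)).ncard = 4 * (n - 2) - 2) := by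
  classical
  have hJ' : b.dynkinGraph.CutConnected J := cutConnected_iff.mpr hJ
  obtain ⟨hfin, hdim⟩ := hV.finrank_weightSpace hμ hJ
  rw [ncard_restrictedPartitions_theta]
  refine ⟨⟨finite_restrictedPartitions_theta, hfin, hdim⟩, fun h1 ↦ ?_, fun h2 ↦ ?_,
    fun n h3 hD ↦ hD.ncard_connectedPartitions hsupp h3,
    fun n h3 hE ↦ hE.ncard_connectedPartitions hsupp h3⟩
  · obtain ⟨s, hs⟩ := Set.ncard_eq_one.mp h1
    have hmem : ∀ x, x ∈ b.weightSupport μ ∧ x ∈ J ↔ x = s := fun x ↦ Set.ext_iff.mp hs x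
    exact ncard_connectedPartitions_of_unique hJ' ((hmem s).mpr rfl).2 fun x hx ↦ by
      rw [← hmem, and_iff_left hx]
  · obtain ⟨s, s', -, hs⟩ := Set.ncard_eq_two.mp h2
    have hmem : ∀ x, x ∈ b.weightSupport μ ∧ x ∈ J ↔ x = s ∨ x = s' := fun x ↦ Set.ext_iff.mp hs x
    rw [hs]
    exact ncard_connectedPartitions_of_pair b.hasLeaves_dynkinGraph hJ'
      ((hmem s).mpr (Or.inl rfl)).2 ((hmem s').mpr (Or.inr rfl)).2 fun x hx ↦ by
        rw [← hmem, and_iff_left hx]
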